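/- **Setting.** Let $s\in(0,1)$, $n>2s$, let $\Omega\subset\mathbb R^n$ be open and bounded, and let $K:\mathbb R^n\setminus\{0\}\to(0,+\infty)$ be such that $x\mapsto\min\{|x|^2,1\}K(x)$ is in $L^1(\mathbb R^n)$ and, for some $\theta>0$, $K(x)\ge\theta|x|^{-(n+2s)}$ for all $x\ne0$. Let $X_0$ be the space of Lebesgue measurable $u:\mathbb R^n\to\mathbb R$ with $u|_\Omega\in L^2(\Omega)$, $u=0$ a.e. in $\mathbb R^n\setminus\Omega$ and $(x,y)\mapsto(u(x)-u(y))\sqrt{K(x-y)}$ in $L^2\big(\mathbb R^n\times\mathbb R^n\setminus(\Omega^c\times\Omega^c)\big)$, with $$\langle u,v\rangle_{X_0}=\int_{\mathbb R^n\times\mathbb R^n}(u(x)-u(y))(v(x)-v(y))K(x-y)\,dx\,dy,\qquad \|u\|_{X_0}=\langle u,u\rangle_{X_0}^{1/2}.$$ Let $f:\Omega\times\mathbb R\to\mathbb R$ be a Carathéodory function and $F(x,t)=\int_0^tf(x,\tau)\,d\tau$. Suppose that, for some $q\in(2,2n/(n-2s))$ and constants $a_1,a_2,a_3,a_4>0$,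 for a.e. $x\in\Omega$: - $|f(x,t)|\le a_1+a_2|t|^{q-1}$ for all $t\in\mathbb R$; - $F(x,t)\ge a_3|t|^q-a_4$ for all $t\in\mathbb R$; - $0<qF(x,t)\le tf(x,t)$ for all $t\ne0$; and that $f(x,t)/|t|\to0$ as $t\to0$, uniformly in $x\in\Omega$. For $\lambda\in\mathbb R$ and $u\in X_0$ put $$\mathcal J_\lambda(u)=\frac12\|u\|_{X_0}^2-\frac\lambda2\int_\Omega|u|^2\,dx-\int_\Omega F(x,u(x))\,dx .$$ Call $\mu\in\mathbb R$ an eigenvalue, with eigenfunction $u\in X_0\setminus\{0\}$, if $\langle u,\varphi\rangle_{X_0}=\mu\int_\Omega u\varphi\,dx$ for all $\varphi\in X_0$. Let $\lambda_1\le\lambda_2\le\cdots$ be the sequence of all eigenvalues, each repeated according to its multiplicity, and let $e_1,e_2,\dots$ be corresponding eigenfunctions, orthonormal in $L^2(\Omega)$. (So every eigenfunction for an eigenvalue $\mu$ is a linear combination of the $e_j$ with $\lambda_j=\mu$.) **Proposition.** Let $k\ge2$ and $m\ge1$ be integers and let $\lambda\in\mathbb R$ satisfy $$\lambda_{k-1}<\lambda<\lambda_k=\dots=\lambda_{k+m-1}<\lambda_{k+m}.$$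 Put $X_1=\operatorname{span}\{e_1,\dots,e_{k-1}\}$, $X_2=\operatorname{span}\{e_k,\dots,e_{k+m-1}\}$ and $X_3=\{u\in X_0:\langle u,e_j\rangle_{X_0}=0\text{ for }j=1,\dots,k+m-1\}$. Then there exist $R>\rho>0$ such that the following supremum and infimum are finite and $$\sup_{\{u\in X_1:\ \|u\|_{X_0}\le R\}\,\cup\,\{u\in X_1\oplus X_2:\ \|u\|_{X_0}=R\}}\mathcal J_\lambda\;<\;\inf_{\{u\in X_2\oplus X_3:\ \|u\|_{X_0}=\rho\}}\mathcal J_\lambda .$$ -/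

import Mathlib

open MeasureTheory Set Filter Topology

noncomputable section

namespace Nonlocal

/-- The space `ℝⁿ` with the Euclidean norm and Lebesgue measure. -/
abbrev E (n : ℕ) : Type := EuclideanSpace ℝ (Fin n)

/-- The kernels `K : ℝⁿ ∖ {0} → (0, ∞)` of order `s`. The value at `0` plays no role. -/
structure Kernel (n : ℕ) (s : ℝ) where
  toFun : E n → ℝ
  pos : ∀ x, x ≠ 0 → 0 < toFun x
  /-- `m K ∈ L¹(ℝⁿ)` with `m(x) = min {|x|², 1}`. -/
  integrable : Integrable (fun x => min (‖x‖ ^ 2) 1 * toFun x) volume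
  /-- `K(x) ≥ θ |x|^{-(n+2s)}` for `x ≠ 0`. -/
  lower_bound : ∃ θ : ℝ, 0 < θ ∧ ∀ x, x ≠ 0 → θ * ‖x‖ ^ (-((n : ℝ) + 2 * s)) ≤ toFun x

instance {n : ℕ} {s : ℝ} : CoeFun (Kernel n s) (fun _ => E n → ℝ) := ⟨Kernel.toFun⟩

variable {n : ℕ} {s : ℝ}

/-- The map `(x, y) ↦ (u(x) - u(y)) √K(x - y)`. -/
def diffQuot (K : Kernel n s) (u : E n → ℝ) (p : E n × E n) : ℝ :=
  (u p.1 - u p.2) * √(K (p.1 - p.2))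

/-- The space `X`: Lebesgue measurable `u : ℝⁿ → ℝ` with `u|_Ω ∈ L²(Ω)` and
`(x, y) ↦ (u(x) - u(y)) √K(x - y)` in `L²(ℝⁿ × ℝⁿ ∖ (Ωᶜ × Ωᶜ))`. -/
def MemX (Ω : TopologicalSpace.Opens (E n)) (K : Kernel n s) (u : E n → ℝ) : Prop :=
  AEMeasurable u volume ∧
  MemLp u 2 (volume.restrict (Ω : Set (E n))) ∧
  MemLp (diffQuot K u) 2 (volume.restrict ((Ω : Set (E n))ᶜ ×ˢ (Ω : Set (E n))ᶜ)ᶜ)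

/-- The space `X₀ = {u ∈ X : u = 0 a.e. in ℝⁿ ∖ Ω}`. Its elements are functions; functions that
agree a.e. are not distinguished by anything below. -/
def X0 (Ω : TopologicalSpace.Opens (E n)) (K : Kernel n s) : Submodule ℝ (E n → ℝ) where
  carrier := {u | MemX Ω K u ∧ ∀ᵐ x ∂(volume : Measure (E n)), x ∉ Ω → u x = 0}
  zero_mem' := by
    have h : diffQuot K (0 : E n → ℝ) = 0 := by ext p; simp [diffQuot]
    refine ⟨⟨aemeasurable_const, MemLp.zero, ?_⟩, by simp⟩
    rw [h]; exact MemLp.zero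
  add_mem' := by
    rintro u v ⟨⟨hu1, hu2, hu3⟩, hu4⟩ ⟨⟨hv1, hv2, hv3⟩, hv4⟩
    have h : diffQuot K (u + v) = diffQuot K u + diffQuot K v := by
      ext p; simp only [diffQuot, Pi.add_apply]; ring
    refine ⟨⟨hu1.add hv1, hu2.add hv2, ?_⟩, ?_⟩
    · rw [h]; exact hu3.add hv3
    · filter_upwards [hu4, hv4] with x hx hy hxΩ
      simp [hx hxΩ, hy hxΩ]
  smul_mem' := by
    rintro c u ⟨⟨hu1, hu2, hu3⟩, hu4⟩
    have h : diffQuot K (c • u) = c • diffQuot K u := by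
      ext p; simp only [diffQuot, Pi.smul_apply, smul_eq_mul]; ring
    refine ⟨⟨hu1.const_smul c, hu2.const_smul c, ?_⟩, ?_⟩
    · rw [h]; exact hu3.const_smul c
    · filter_upwards [hu4] with x hx hxΩ
      simp [hx hxΩ]

variable {Ω : TopologicalSpace.Opens (E n)} {K : Kernel n s}

/-- `⟨u, v⟩_{X₀} = ∫_{ℝⁿ×ℝⁿ} (u(x) - u(y)) (v(x) - v(y)) K(x - y) dx dy`. -/
def innerX0 (u v : X0 Ω K) : ℝ :=
  ∫ p : E n × E n, (u.1 p.1 - u.1 p.2) * (v.1 p.1 - v.1 p.2) * K (p.1 - p.2)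

/-- `‖u‖_{X₀} = (∫_{ℝⁿ×ℝⁿ} |u(x) - u(y)|² K(x - y) dx dy)^{1/2}`. -/
def normX0 (u : X0 Ω K) : ℝ :=
  √(∫ p : E n × E n, |u.1 p.1 - u.1 p.2| ^ 2 * K (p.1 - p.2))

/-- For `u ∈ X₀` the difference map is square integrable on all of `ℝⁿ × ℝⁿ`. -/
theorem memLp_diffQuot (u : X0 Ω K) : MemLp (diffQuot K u.1) 2 volume := by
  obtain ⟨u, ⟨-, -, h⟩, h0⟩ := u
  have hS : MeasurableSet ((Ω : Set (E n))ᶜ ×ˢ (Ω : Set (E n))ᶜ)ᶜ :=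
    (Ω.isOpen.measurableSet.compl.prod Ω.isOpen.measurableSet.compl).compl
  rw [← memLp_indicator_iff_restrict hS] at h
  refine h.ae_eq ?_
  have h1 : ∀ᵐ p : E n × E n, p.1 ∉ Ω → u p.1 = 0 :=
    Measure.quasiMeasurePreserving_fst.ae h0
  have h2 : ∀ᵐ p : E n × E n, p.2 ∉ Ω → u p.2 = 0 :=
    Measure.quasiMeasurePreserving_snd.ae h0
  filter_upwards [h1, h2] with p hp1 hp2
  by_cases hp : p ∈ ((Ω : Set (E n))ᶜ ×ˢ (Ω : Set (E n))ᶜ)ᶜ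
  · rw [indicator_of_mem hp]
  · rw [indicator_of_notMem hp]
    have hp' : p ∈ (Ω : Set (E n))ᶜ ×ˢ (Ω : Set (E n))ᶜ := by simpa using hp
    simp [diffQuot, hp1 hp'.1, hp2 hp'.2]

theorem integrable_innerX0 (u v : X0 Ω K) :
    Integrable (fun p : E n × E n =>
      (u.1 p.1 - u.1 p.2) * (v.1 p.1 - v.1 p.2) * K (p.1 - p.2)) volume := by
  refine ((memLp_diffQuot u).integrable_mul (memLp_diffQuot v)).congr (ae_of_all _ fun p => ?_)
  simp only [Pi.mul_apply, diffQuot]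
  by_cases hp : p.1 - p.2 = 0
  · simp [sub_eq_zero.mp hp]
  · have := Real.mul_self_sqrt (K.pos _ hp).le
    linear_combination (u.1 p.1 - u.1 p.2) * (v.1 p.1 - v.1 p.2) * this

theorem innerX0_add_left (u v w : X0 Ω K) :
    innerX0 (u + v) w = innerX0 u w + innerX0 v w := by
  unfold innerX0
  rw [← integral_add (integrable_innerX0 u w) (integrable_innerX0 v w)]
  congr 1; ext p; simp only [Submodule.coe_add, Pi.add_apply]; ring

theorem innerX0_smul_left (c : ℝ) (u w : X0 Ω K) :
    innerX0 (c • u) w = c * innerX0 u w := by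
  unfold innerX0
  rw [← integral_const_mul]
  congr 1; ext p; simp only [Submodule.coe_smul, Pi.smul_apply, smul_eq_mul]; ring

/-- `u` is a (nontrivial, weak) eigenfunction of `-L_K` in `Ω`, with `u = 0` outside `Ω`, for the
eigenvalue `μ`. -/
def IsEigenfunction (μ : ℝ) (u : X0 Ω K) : Prop :=
  (¬ u.1 =ᵐ[volume] 0) ∧
  ∀ φ : X0 Ω K, innerX0 u φ = μ * ∫ x in (Ω : Set (E n)), u.1 x * φ.1 x

/-- `lam 1 ≤ lam 2 ≤ …` is the sequence of all eigenvalues of `-L_K`, each one repeated according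
to its multiplicity, and `e 1, e 2, …` are corresponding eigenfunctions, orthonormal in `L²(Ω)`.
Indices start at `1`; the values at `0` play no role. -/
structure IsEigenSequence (lam : ℕ → ℝ) (e : ℕ → X0 Ω K) : Prop where
  mono : ∀ i j, 1 ≤ i → i ≤ j → lam i ≤ lam j
  eigen : ∀ j, 1 ≤ j → IsEigenfunction (lam j) (e j)
  orthonormal : ∀ i j, 1 ≤ i → 1 ≤ j →
    ∫ x in (Ω : Set (E n)), (e i).1 x * (e j).1 x = if i = j then 1 else 0
  /-- The list is complete: each eigenspace is spanned by those `e j` that belong to it. -/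
  exhaust : ∀ (μ : ℝ) (u : X0 Ω K), IsEigenfunction μ u →
    ∃ v ∈ Submodule.span ℝ (e '' {j | 1 ≤ j ∧ lam j = μ}), u.1 =ᵐ[volume] v.1

/-- `span {e_i, …, e_j}`. -/
def spanE (e : ℕ → X0 Ω K) (i j : ℕ) : Submodule ℝ (X0 Ω K) :=
  Submodule.span ℝ (e '' Icc i j)

/-- `H_k = span {e_1, …, e_k}`. -/
def H (e : ℕ → X0 Ω K) (k : ℕ) : Submodule ℝ (X0 Ω K) := spanE e 1 k

/-- `P_k = {u ∈ X₀ : ⟨u, e_j⟩_{X₀} = 0 for j = 1, …, k}`. -/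
def P (e : ℕ → X0 Ω K) (k : ℕ) : Submodule ℝ (X0 Ω K) where
  carrier := {u | ∀ j, 1 ≤ j → j ≤ k → innerX0 u (e j) = 0}
  zero_mem' := by
    intro j _ _
    simp [innerX0]
  add_mem' := by
    intro u v hu hv j h1 h2
    rw [innerX0_add_left, hu j h1 h2, hv j h1 h2, add_zero]
  smul_mem' := by
    intro c u hu j h1 h2
    rw [innerX0_smul_left, hu j h1 h2, mul_zero]

/-- `F(x, t) = ∫₀ᵗ f(x, τ) dτ`. -/
def primitive (f : E n → ℝ → ℝ) (x : E n) (t : ℝ) : ℝ := ∫ τ in (0 : ℝ)..t, f x τ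

/-- The assumptions on the nonlinearity `f : Ω × ℝ → ℝ` (values of `f x` for `x ∉ Ω` play no
role); `q` is the common exponent. -/
structure IsNonlinearity (Ω : TopologicalSpace.Opens (E n)) (s q : ℝ) (f : E n → ℝ → ℝ) :
    Prop where
  /-- Carathéodory: measurable in `x` for every `t`, ... -/
  measurable : ∀ t, AEMeasurable (fun x => f x t) (volume.restrict (Ω : Set (E n)))
  /-- ... and continuous in `t` for a.e. `x`. -/
  continuous : ∀ᵐ x ∂(volume.restrict (Ω : Set (E n))), Continuous (f x)
  two_lt : 2 < q
  /-- `q < 2^* = 2n/(n-2s)`. -/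
  lt_critical : q < 2 * (n : ℝ) / ((n : ℝ) - 2 * s)
  growth : ∃ a₁ a₂ : ℝ, 0 < a₁ ∧ 0 < a₂ ∧
    ∀ᵐ x ∂(volume.restrict (Ω : Set (E n))), ∀ t : ℝ, |f x t| ≤ a₁ + a₂ * |t| ^ (q - 1)
  primitive_lower : ∃ a₃ a₄ : ℝ, 0 < a₃ ∧ 0 < a₄ ∧
    ∀ᵐ x ∂(volume.restrict (Ω : Set (E n))), ∀ t : ℝ, a₃ * |t| ^ q - a₄ ≤ primitive f x t
  /-- `f(x,t)/|t| → 0` as `t → 0`, uniformly in `x ∈ Ω`. -/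
  superlinear_zero :
    TendstoUniformlyOn (fun t x => f x t / |t|) (fun _ => 0) (𝓝[≠] (0 : ℝ)) (Ω : Set (E n))
  /-- `0 < q F(x,t) ≤ t f(x,t)` for `t ≠ 0`. -/
  ambrosetti_rabinowitz : ∀ᵐ x ∂(volume.restrict (Ω : Set (E n))), ∀ t : ℝ, t ≠ 0 →
    0 < q * primitive f x t ∧ q * primitive f x t ≤ t * f x t

/-- The functional `J_λ : X₀ → ℝ`. -/
def J (f : E n → ℝ → ℝ) (lam : ℝ) (u : X0 Ω K) : ℝ :=
  1 / 2 * (∫ p : E n × E n, |u.1 p.1 - u.1 p.2| ^ 2 * K (p.1 - p.2))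
    - lam / 2 * (∫ x in (Ω : Set (E n)), |u.1 x| ^ 2)
    - ∫ x in (Ω : Set (E n)), primitive f x (u.1 x)

end Nonlocal

end

noncomputable section

namespace Nonlocal

variable {n : ℕ} {s : ℝ}

open scoped ENNReal

/-! The value `0` separates the two sets: the supremum is at most `0` and the infimum is at least
some `α > 0`. Write `|u|` for the `L²(Ω)` norm and `‖u‖` for the `X₀` norm.

Upper side. On `span {e_1, …, e_N}` one has `‖u‖² ≤ λ_N |u|²`. For `N = k - 1` this and `F ≥ 0` give
`J ≤ 0` (`J_nonpos_of_mem_H`). For `N = k + m - 1`, `F` eventually dominates any multiple of `t²`,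
so `J ≤ 0` on large spheres (`exists_J_nonpos_of_large`).

Lower side. `X₂ ⊕ X₃` is orthogonal to `e_1, …, e_{k-1}`, and there `‖u‖² ≥ λ_k |u|²`. Since `|F| ≤
ε t² + C |t|^q` with `q > 2`, the Sobolev embedding makes the quadratic part, which is at least `κ
‖u‖²`, win on a small sphere (`exists_pos_le_J`).

Two analytic facts carry this. The first is the embedding of `X₀` in `L^q(Ω)`, derived from a
pointwise lower bound for the Gagliardo density. The second is the inequality `‖u‖² ≥ λ_k |u|²`
(`le_innerX0_of_mem_P`), where the `e_j` are only assumed to exhaust the eigenspaces. It follows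
from the spectral theory of the compact embedding `X₀ → L²`: a smaller value of the quotient would
force an eigenvalue below `λ_k` with an eigenfunction orthogonal to `e_1, …, e_{k-1}`. -/

/-! ### The fractional Sobolev inequality. -/

/-- The density `x ↦ ∫ |u(x) - u(y)|² |x - y|^{-(n+2s)} dy` of the Gagliardo seminorm. -/
def gagliardoDensity (s : ℝ) (u : E n → ℝ) (x : E n) : ℝ≥0∞ :=
  ∫⁻ y, ENNReal.ofReal ((u x - u y) ^ 2 * ‖x - y‖ ^ (-((n : ℝ) + 2 * s)))

/-- The volume of the unit ball of `ℝⁿ`. -/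
def unitBallVolume (n : ℕ) : ℝ := (volume (Metric.ball (0 : E n) 1)).toReal

theorem unitBallVolume_pos : 0 < unitBallVolume n :=
  ENNReal.toReal_pos (Metric.measure_ball_pos _ _ one_pos).ne' measure_ball_lt_top.ne

theorem volume_ball_eq (x : E n) {r : ℝ} (hr : 0 < r) :
    volume (Metric.ball x r) = ENNReal.ofReal (r ^ (n : ℝ) * unitBallVolume n) := by
  rw [Measure.addHaar_ball_of_pos _ _ hr, finrank_euclideanSpace_fin, Real.rpow_natCast,
    ENNReal.ofReal_mul (by positivity), unitBallVolume,
    ENNReal.ofReal_toReal measure_ball_lt_top.ne]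

theorem aemeasurable_gagliardo_integrand {u : E n → ℝ} (hu : AEMeasurable u volume) (x : E n) :
    AEMeasurable (fun y =>
      ENNReal.ofReal ((u x - u y) ^ 2 * ‖x - y‖ ^ (-((n : ℝ) + 2 * s)))) volume := by
  refine AEMeasurable.ennreal_ofReal (((hu.const_sub _).pow_const 2).mul ?_)
  exact (by fun_prop : Measurable fun y : E n => ‖x - y‖ ^ (-((n : ℝ) + 2 * s))).aemeasurable

/-- A lower bound for the Gagliardo density from a large set of small values. -/
theorem le_gagliardoDensity_of_measure_le {u : E n → ℝ} (hu : AEMeasurable u volume) (hs : 0 < s)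
    (x : E n) {a r V : ℝ} (hr : 0 < r) (ha : 0 < a) (hV : 0 ≤ V) (hx : |u x| = a)
    (hball : 2 * V = r ^ (n : ℝ) * unitBallVolume n)
    (hle : volume {y | a / 2 ≤ |u y|} ≤ ENNReal.ofReal V) :
    ENNReal.ofReal (a ^ 2 / 4 * r ^ (-((n : ℝ) + 2 * s)) * V) ≤ gagliardoDensity s u x := by
  -- The ball has volume `2V` and large values occupy at most `V`, so `S` has volume at least `V`;
  -- on `S` the integrand is at least `a²/4 · r^{-(n+2s)}`.
  set S : Set (E n) := {y | y ∈ Metric.ball x r ∧ |u y| < a / 2}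
  have hS : ENNReal.ofReal V ≤ volume S := by
    have h1 : volume (Metric.ball x r) ≤ volume S + volume {y | a / 2 ≤ |u y|} := by
      refine (measure_mono fun y hy => ?_).trans (measure_union_le _ _)
      by_cases h : a / 2 ≤ |u y|
      · exact Or.inr h
      · exact Or.inl ⟨hy, not_le.mp h⟩
    rw [volume_ball_eq x hr, ← hball, two_mul, ENNReal.ofReal_add hV hV] at h1
    exact ENNReal.le_of_add_le_add_right ENNReal.ofReal_ne_top (h1.trans (by gcongr))
  have hc : 0 ≤ a ^ 2 / 4 * r ^ (-((n : ℝ) + 2 * s)) := by positivity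
  rw [ENNReal.ofReal_mul hc]
  refine (mul_le_mul_right hS _).trans ?_
  refine le_trans (mul_le_mul_right (measure_mono ?_) _)
    (mul_meas_ge_le_lintegral₀ (aemeasurable_gagliardo_integrand hu x) _)
  rintro y ⟨hy, hyu⟩
  refine ENNReal.ofReal_le_ofReal ?_
  have hxy : x ≠ y := by
    rintro rfl
    linarith
  have h1 : a / 2 ≤ |u x - u y| := by
    have := abs_sub_abs_le_abs_sub (u x) (u y)
    linarith
  have h2 : a ^ 2 / 4 ≤ (u x - u y) ^ 2 := by
    rw [← sq_abs (u x - u y)]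
    nlinarith
  have h3 : ‖x - y‖ ≤ r := by
    rw [← dist_eq_norm, dist_comm]
    exact (Metric.mem_ball.mp hy).le
  have h4 : 0 < ‖x - y‖ := norm_pos_iff.mpr (sub_ne_zero.mpr hxy)
  have h5 : (0 : ℝ) ≤ n := Nat.cast_nonneg n
  exact mul_le_mul h2 (Real.rpow_le_rpow_of_nonpos h4 h3 (by linarith)) (by positivity)
    (by positivity)

/-- The constant in the pointwise estimate behind the fractional Sobolev inequality. -/
def sobolevConst (n : ℕ) (s : ℝ) : ℝ :=
  unitBallVolume n / 8 *
    (2 ^ (2 * (n : ℝ) / (n - 2 * s) + 1) / unitBallVolume n) ^ (-(2 * s / n))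

theorem sobolevConst_pos : 0 < sobolevConst n s := by
  have := unitBallVolume_pos (n := n)
  unfold sobolevConst
  positivity

/-- By Chebyshev, `|u| ≥ |u x| / 2` can fill at most half of a ball around `x` of suitable radius
`r`. The rest of the ball contributes a multiple of `|u x|² r^{-2s}` to the density, and the
critical exponent `p` satisfies `2sp/n = p - 2`, which turns this into `|u x|^p`. -/
theorem rpow_le_gagliardoDensity {u : E n → ℝ} (hu : AEMeasurable u volume) (hs : 0 < s)
    (hn : 2 * s < n) {N : ℝ} (hN : 0 < N)
    (hint : ∫⁻ y, ENNReal.ofReal (|u y| ^ (2 * (n : ℝ) / (n - 2 * s))) ≤ ENNReal.ofReal N)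
    (x : E n) :
    ENNReal.ofReal (sobolevConst n s * N ^ (-(2 * s / n)) *
      |u x| ^ (2 * (n : ℝ) / (n - 2 * s))) ≤ gagliardoDensity s u x := by
  set p : ℝ := 2 * (n : ℝ) / (n - 2 * s) with hp
  have hn0 : (0 : ℝ) < n := by linarith
  have hns : (0 : ℝ) < n - 2 * s := by linarith
  have hp0 : 0 < p := by positivity
  set w := unitBallVolume n
  have hw : 0 < w := unitBallVolume_pos
  rcases (abs_nonneg (u x)).eq_or_lt with h0 | ha
  · rw [← h0, Real.zero_rpow hp0.ne']
    simp
  set a := |u x| with hadef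
  -- `X = r^n`, where `r` is the radius whose ball has twice the Chebyshev volume `N / (a/2)^p`.
  set X : ℝ := 2 ^ (p + 1) * N / (w * a ^ p) with hX
  have hXpos : 0 < X := by positivity
  set r : ℝ := X ^ (1 / (n : ℝ)) with hr
  have hrpos : 0 < r := by positivity
  have hrn : r ^ (n : ℝ) = X := by
    rw [hr, ← Real.rpow_mul hXpos.le]; field_simp; simp
  have hle : volume {y | a / 2 ≤ |u y|} ≤ ENNReal.ofReal (w * X / 2) := by
    have h1 : w * X / 2 = N / (a / 2) ^ p := by
      rw [hX, Real.div_rpow ha.le zero_le_two, Real.rpow_add zero_lt_two, Real.rpow_one]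
      field_simp
    rw [h1, ENNReal.ofReal_div_of_pos (by positivity),
      ENNReal.le_div_iff_mul_le (by left; simp; positivity) (by simp), mul_comm]
    refine le_trans ?_ hint
    refine le_trans (mul_le_mul_right (measure_mono ?_) _)
      (mul_meas_ge_le_lintegral₀ (by fun_prop) _)
    intro y hy
    exact ENNReal.ofReal_le_ofReal (Real.rpow_le_rpow (by positivity) hy hp0.le)
  refine le_trans (le_of_eq ?_) (le_gagliardoDensity_of_measure_le hu hs x hrpos ha
    (V := w * X / 2) (by positivity) rfl (by rw [hrn]; ring) hle)
  congr 1
  have e1 : r ^ (-((n : ℝ) + 2 * s)) = X⁻¹ * X ^ (-(2 * s / n)) := by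
    rw [hr, ← Real.rpow_mul hXpos.le, ← Real.rpow_neg_one X, ← Real.rpow_add hXpos]
    congr 1
    field_simp
    ring
  have e2 : X ^ (-(2 * s / n)) =
      (2 ^ (p + 1) / w) ^ (-(2 * s / n)) * N ^ (-(2 * s / n)) * a ^ (p - 2) := by
    have : X = (2 ^ (p + 1) / w) * N * (a ^ p)⁻¹ := by rw [hX]; field_simp
    rw [this, Real.mul_rpow (by positivity) (by positivity),
      Real.mul_rpow (by positivity) (by positivity), ← Real.rpow_neg ha.le,
      ← Real.rpow_mul ha.le]
    congr 2
    rw [hp]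
    field_simp
    ring
  have e3 : a ^ p = a ^ 2 * a ^ (p - 2) := by
    rw [← Real.rpow_natCast a 2, ← Real.rpow_add ha]; norm_num
  have e4 : sobolevConst n s = w / 8 * (2 ^ (p + 1) / w) ^ (-(2 * s / n)) := rfl
  rw [e1, e2, e3, e4]
  generalize (2 ^ (p + 1) / w) ^ (-(2 * s / (n : ℝ))) = c
  field_simp
  ring

/-- The a priori form of the fractional Sobolev inequality. -/
theorem sobolev_of_integrable {u : E n → ℝ} (hu : AEMeasurable u volume) (hs : 0 < s)
    (hn : 2 * s < n)
    (hfin : ∫⁻ y, ENNReal.ofReal (|u y| ^ (2 * (n : ℝ) / (n - 2 * s))) ≠ ∞) :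
    ∫⁻ y, ENNReal.ofReal (|u y| ^ (2 * (n : ℝ) / (n - 2 * s))) ≤
      ((∫⁻ x, gagliardoDensity s u x) / ENNReal.ofReal (sobolevConst n s)) ^
        ((n : ℝ) / (n - 2 * s)) := by
  set p : ℝ := 2 * (n : ℝ) / (n - 2 * s) with hp
  have hn0 : (0 : ℝ) < n := by linarith
  have hns : (0 : ℝ) < n - 2 * s := by linarith
  have hc : 0 < sobolevConst n s := sobolevConst_pos
  obtain ⟨N, hN⟩ : ∃ N : ℝ, N = (∫⁻ y, ENNReal.ofReal (|u y| ^ p)).toReal := ⟨_, rfl⟩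
  have hNe : ∫⁻ y, ENNReal.ofReal (|u y| ^ p) = ENNReal.ofReal N := by
    rw [hN, ENNReal.ofReal_toReal hfin]
  rw [hNe]
  rcases (hN ▸ ENNReal.toReal_nonneg : 0 ≤ N).eq_or_lt with h0 | hNpos
  · simp [← h0]
  -- Integrating the pointwise bound leaves `N^{1 - 2s/n}` on the left; combining the powers needs
  -- `0 < N < ∞`, hence the a priori finiteness.
  have h1 : ENNReal.ofReal (sobolevConst n s * N ^ (-(2 * s / n))) * ENNReal.ofReal N ≤
      ∫⁻ x, gagliardoDensity s u x := by
    rw [← hNe, ← lintegral_const_mul' _ _ ENNReal.ofReal_ne_top]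
    refine lintegral_mono fun x => ?_
    rw [← ENNReal.ofReal_mul (by positivity)]
    exact rpow_le_gagliardoDensity hu hs hn hNpos hNe.le x
  have h2 : ENNReal.ofReal (N ^ (1 - 2 * s / n)) ≤
      (∫⁻ x, gagliardoDensity s u x) / ENNReal.ofReal (sobolevConst n s) := by
    rw [ENNReal.le_div_iff_mul_le (by left; simpa using hc) (by simp)]
    refine le_trans (le_of_eq ?_) h1
    rw [← ENNReal.ofReal_mul (by positivity), ← ENNReal.ofReal_mul (by positivity)]
    congr 1
    rw [sub_eq_neg_add, Real.rpow_add hNpos, Real.rpow_one]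
    ring
  have h3 : ENNReal.ofReal N = ENNReal.ofReal (N ^ (1 - 2 * s / n)) ^ ((n : ℝ) / (n - 2 * s)) := by
    rw [ENNReal.ofReal_rpow_of_pos (by positivity), ← Real.rpow_mul hNpos.le]
    rw [show (1 - 2 * s / n) * ((n : ℝ) / (n - 2 * s)) = 1 by field_simp, Real.rpow_one]
  rw [h3]
  exact ENNReal.rpow_le_rpow h2 (by positivity)

/-- Truncation of a real number at height `T`. -/
def truncate (T t : ℝ) : ℝ := max (-T) (min t T)

theorem abs_truncate_le {T : ℝ} (hT : 0 ≤ T) (t : ℝ) : |truncate T t| ≤ T := by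
  unfold truncate
  rw [abs_le]
  exact ⟨le_max_left _ _, max_le (by linarith) (min_le_right _ _)⟩

theorem abs_truncate_le_abs {T : ℝ} (hT : 0 ≤ T) (t : ℝ) : |truncate T t| ≤ |t| := by
  unfold truncate
  rw [abs_le]
  constructor
  · exact le_max_of_le_right (le_min (neg_abs_le t) (by linarith [abs_nonneg t]))
  · exact max_le (by linarith [abs_nonneg t]) ((min_le_left _ _).trans (le_abs_self t))

theorem abs_truncate_sub_le (T t t' : ℝ) : |truncate T t - truncate T t'| ≤ |t - t'| := by
  unfold truncate
  refine (abs_max_sub_max_le_max _ _ _ _).trans ?_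
  refine max_le (by simp) ((abs_min_sub_min_le_max _ _ _ _).trans (by simp))

theorem truncate_eq_self {T t : ℝ} (h : |t| ≤ T) : truncate T t = t := by
  obtain ⟨h1, h2⟩ := abs_le.mp h
  rw [truncate, min_eq_left h2, max_eq_right h1]

/-- The **fractional Sobolev inequality**. -/
theorem sobolev_inequality {u : E n → ℝ} (hu : MemLp u 2 volume) (hs : 0 < s) (hn : 2 * s < n) :
    ∫⁻ y, ENNReal.ofReal (|u y| ^ (2 * (n : ℝ) / (n - 2 * s))) ≤
      ((∫⁻ x, gagliardoDensity s u x) / ENNReal.ofReal (sobolevConst n s)) ^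
        ((n : ℝ) / (n - 2 * s)) := by
  set p : ℝ := 2 * (n : ℝ) / (n - 2 * s) with hp
  have hn0 : (0 : ℝ) < n := by linarith
  have hns : (0 : ℝ) < n - 2 * s := by linarith
  have hp0 : 0 < p := by positivity
  have hp2 : 0 ≤ p - 2 := by
    rw [hp, sub_nonneg, le_div_iff₀ hns]; linarith
  have hum : AEMeasurable u volume := hu.1.aemeasurable
  -- Truncations lie in `L² ∩ L^∞`, hence in `L^p`, and do not increase differences, so the a priori
  -- inequality holds with a bound independent of `j`. Fatou's lemma then passes to `u`.
  let v : ℕ → E n → ℝ := fun j x => truncate j (u x)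
  have hvm : ∀ j, AEMeasurable (v j) volume := fun j =>
    (aemeasurable_const).max (hum.min aemeasurable_const)
  have hfin : ∀ j, ∫⁻ y, ENNReal.ofReal (|v j y| ^ p) ≠ ∞ := by
    intro j
    have hi : Integrable (fun y => (j : ℝ) ^ (p - 2) * u y ^ 2) volume :=
      hu.integrable_sq.const_mul _
    refine ne_top_of_le_ne_top hi.lintegral_lt_top.ne (lintegral_mono fun y => ?_)
    refine ENNReal.ofReal_le_ofReal ?_
    rcases (abs_nonneg (v j y)).eq_or_lt with h0 | h0
    · rw [← h0, Real.zero_rpow hp0.ne']; positivity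
    · have : |v j y| ^ p = |v j y| ^ (p - 2) * |v j y| ^ 2 := by
        rw [← Real.rpow_natCast _ 2, ← Real.rpow_add h0]; norm_num
      rw [this, ← sq_abs (u y)]
      have hj : (0 : ℝ) ≤ j := Nat.cast_nonneg j
      have h1 := abs_truncate_le hj (u y)
      have h2 := abs_truncate_le_abs hj (u y)
      exact mul_le_mul (Real.rpow_le_rpow h0.le h1 hp2) (pow_le_pow_left₀ h0.le h2 2)
        (by positivity) (by positivity)
  have hB : ∀ j, ∫⁻ y, ENNReal.ofReal (|v j y| ^ p) ≤
      ((∫⁻ x, gagliardoDensity s u x) / ENNReal.ofReal (sobolevConst n s)) ^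
        ((n : ℝ) / (n - 2 * s)) := by
    intro j
    refine (sobolev_of_integrable (hvm j) hs hn (hfin j)).trans ?_
    refine ENNReal.rpow_le_rpow ?_ (by positivity)
    gcongr with x
    refine lintegral_mono fun y => ENNReal.ofReal_le_ofReal ?_
    refine mul_le_mul_of_nonneg_right ?_ (by positivity)
    exact sq_le_sq.mpr (abs_truncate_sub_le _ _ _)
  have hlim : ∀ y, liminf (fun j => ENNReal.ofReal (|v j y| ^ p)) atTop =
      ENNReal.ofReal (|u y| ^ p) := by
    intro y
    refine Tendsto.liminf_eq (tendsto_const_nhds.congr' ?_)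
    filter_upwards [eventually_ge_atTop ⌈|u y|⌉₊] with j hj
    rw [show v j y = u y from truncate_eq_self ((Nat.le_ceil _).trans (by exact_mod_cast hj))]
  calc ∫⁻ y, ENNReal.ofReal (|u y| ^ p)
      = ∫⁻ y, liminf (fun j => ENNReal.ofReal (|v j y| ^ p)) atTop := by simp_rw [hlim]
    _ ≤ liminf (fun j => ∫⁻ y, ENNReal.ofReal (|v j y| ^ p)) atTop :=
        lintegral_liminf_le' fun j => by have := hvm j; fun_prop
    _ ≤ _ := liminf_le_of_le (by isBoundedDefault) fun b hb => by
        obtain ⟨j, hj⟩ := hb.exists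
        exact hj.trans (hB j)

/-! ### Deviation from ball averages. -/

/-- The Gagliardo density controls the deviation from the mean over a ball. -/
theorem sq_sub_average_le_gagliardoDensity {u : E n → ℝ} (hu : MemLp u 2 volume) (hs : 0 < s)
    {x z : E n} {r : ℝ} (hr : 0 < r) (hx : x ∈ Metric.ball z r) :
    ENNReal.ofReal ((u x - ⨍ y in Metric.ball z r, u y) ^ 2) ≤
      ENNReal.ofReal ((2 * r) ^ ((n : ℝ) + 2 * s) / (r ^ (n : ℝ) * unitBallVolume n)) *
        gagliardoDensity s u x := by
  set B := Metric.ball z r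
  set m := ⨍ y in B, u y with hm
  have hw := unitBallVolume_pos (n := n)
  have hV : volume.real B = r ^ (n : ℝ) * unitBallVolume n := by
    rw [Measure.real, volume_ball_eq z hr, ENNReal.toReal_ofReal (by positivity)]
  set V := r ^ (n : ℝ) * unitBallVolume n with hVdef
  have hVpos : 0 < V := by positivity
  have : IsFiniteMeasure (volume.restrict B) := ⟨by simpa using measure_ball_lt_top⟩
  have huB : MemLp u 2 (volume.restrict B) := hu.restrict _
  have hi1 : Integrable u (volume.restrict B) := huB.integrable (by norm_num)
  have hmV : ∫ y in B, u y = V * m := by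
    rw [hm, setAverage_eq, hV, smul_eq_mul, mul_inv_cancel_left₀ hVpos.ne']
  have hsq : Integrable (fun y => (u x - u y) ^ 2) (volume.restrict B) :=
    ((memLp_const (u x)).sub huB).integrable_sq
  -- The variance identity: the difference of the two sides is `∫ (u y - m)²` over `B`.
  have key : V * (u x - m) ^ 2 ≤ ∫ y in B, (u x - u y) ^ 2 := by
    have h0 : 0 ≤ ∫ y in B, (u y - m) ^ 2 := integral_nonneg fun y => sq_nonneg _
    have h1 : ∫ y in B, ((u x - u y) ^ 2 - (u y - m) ^ 2) = V * (u x - m) ^ 2 := by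
      have : ∀ y, (u x - u y) ^ 2 - (u y - m) ^ 2 = (u x ^ 2 - m ^ 2) - 2 * (u x - m) * u y := by
        intro y; ring
      simp_rw [this]
      rw [integral_sub (integrable_const _) (hi1.const_mul _), integral_const_mul, hmV]
      simp only [integral_const, MeasurableSet.univ, measureReal_restrict_apply, univ_inter, hV,
        smul_eq_mul]
      ring
    have hsq' : Integrable (fun y => (u y - m) ^ 2) (volume.restrict B) :=
      (huB.sub (memLp_const m)).integrable_sq
    rw [integral_sub hsq hsq'] at h1
    linarith
  have h2 : ENNReal.ofReal (V * (u x - m) ^ 2) ≤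
      ENNReal.ofReal ((2 * r) ^ ((n : ℝ) + 2 * s)) * gagliardoDensity s u x := by
    refine (ENNReal.ofReal_le_ofReal key).trans ?_
    rw [ofReal_integral_eq_lintegral_ofReal hsq (ae_of_all _ fun y => sq_nonneg _),
      gagliardoDensity, ← lintegral_const_mul' _ _ ENNReal.ofReal_ne_top]
    refine le_trans ?_ (setLIntegral_le_lintegral B _)
    refine setLIntegral_mono_ae' measurableSet_ball (ae_of_all _ fun y hy => ?_)
    rw [← ENNReal.ofReal_mul (by positivity)]
    refine ENNReal.ofReal_le_ofReal ?_
    rcases eq_or_ne x y with rfl | hxy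
    · simp
    have h4 : 0 < ‖x - y‖ := norm_pos_iff.mpr (sub_ne_zero.mpr hxy)
    have h3 : ‖x - y‖ ≤ 2 * r := by
      rw [← dist_eq_norm]
      have h5 := Metric.mem_ball.mp hx
      have h6 := Metric.mem_ball.mp hy
      linarith [dist_triangle_right x y z]
    rw [Real.rpow_neg h4.le]
    have h7 : ‖x - y‖ ^ ((n : ℝ) + 2 * s) ≤ (2 * r) ^ ((n : ℝ) + 2 * s) :=
      Real.rpow_le_rpow h4.le h3 (by positivity)
    have h8 : 0 < ‖x - y‖ ^ ((n : ℝ) + 2 * s) := by positivity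
    have h9 : 1 ≤ (2 * r) ^ ((n : ℝ) + 2 * s) * (‖x - y‖ ^ ((n : ℝ) + 2 * s))⁻¹ := by
      rwa [← div_eq_mul_inv, one_le_div h8]
    nlinarith [sq_nonneg (u x - u y)]
  calc ENNReal.ofReal ((u x - m) ^ 2)
      = ENNReal.ofReal V⁻¹ * ENNReal.ofReal (V * (u x - m) ^ 2) := by
        rw [← ENNReal.ofReal_mul (by positivity), inv_mul_cancel_left₀ hVpos.ne']
    _ ≤ ENNReal.ofReal V⁻¹ *
          (ENNReal.ofReal ((2 * r) ^ ((n : ℝ) + 2 * s)) * gagliardoDensity s u x) := by gcongr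
    _ = _ := by
        rw [← mul_assoc, ← ENNReal.ofReal_mul (by positivity), div_eq_inv_mul]

/-! ### Embeddings of `X₀` in Lebesgue spaces. -/

variable {Ω : TopologicalSpace.Opens (E n)} {K : Kernel n s}

theorem memLp_two (u : X0 Ω K) : MemLp u.1 2 (volume : Measure (E n)) := by
  have h := u.2.1.2.1
  rw [← memLp_indicator_iff_restrict Ω.isOpen.measurableSet] at h
  refine h.ae_eq ?_
  filter_upwards [u.2.2] with x hx
  by_cases hxΩ : x ∈ (Ω : Set (E n))
  · rw [indicator_of_mem hxΩ]
  · rw [indicator_of_notMem hxΩ, hx hxΩ]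

theorem diffQuot_mul_diffQuot (u v : E n → ℝ) (p : E n × E n) :
    diffQuot K u p * diffQuot K v p =
      (u p.1 - u p.2) * (v p.1 - v p.2) * K (p.1 - p.2) := by
  simp only [diffQuot]
  by_cases hp : p.1 - p.2 = 0
  · simp [sub_eq_zero.mp hp]
  · have := Real.mul_self_sqrt (K.pos _ hp).le
    linear_combination (u p.1 - u p.2) * (v p.1 - v p.2) * this

theorem innerX0_eq_integral (u v : X0 Ω K) :
    innerX0 u v = ∫ p, diffQuot K u.1 p * diffQuot K v.1 p := by
  simp_rw [diffQuot_mul_diffQuot]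
  rfl

theorem integral_sq_eq_innerX0 (u : X0 Ω K) :
    ∫ p : E n × E n, |u.1 p.1 - u.1 p.2| ^ 2 * K (p.1 - p.2) = innerX0 u u := by
  simp_rw [sq_abs, sq]
  rfl

theorem innerX0_self_nonneg (u : X0 Ω K) : 0 ≤ innerX0 u u := by
  rw [innerX0_eq_integral]
  exact integral_nonneg fun p => mul_self_nonneg _

theorem normX0_sq (u : X0 Ω K) : normX0 u ^ 2 = innerX0 u u := by
  rw [normX0, integral_sq_eq_innerX0, Real.sq_sqrt (innerX0_self_nonneg u)]

theorem normX0_nonneg (u : X0 Ω K) : 0 ≤ normX0 u := Real.sqrt_nonneg _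

theorem innerX0_comm (u v : X0 Ω K) : innerX0 u v = innerX0 v u := by
  simp only [innerX0_eq_integral, mul_comm]

variable (Ω K) in
/-- The Gagliardo seminorm is controlled by the norm of `X₀`. -/
theorem exists_lintegral_gagliardoDensity_le :
    ∃ C : ℝ, 0 < C ∧ ∀ u : X0 Ω K,
      ∫⁻ x, gagliardoDensity s u.1 x ≤ ENNReal.ofReal (C * normX0 u ^ 2) := by
  obtain ⟨θ, hθ, hK⟩ := K.lower_bound
  refine ⟨θ⁻¹, by positivity, fun u => ?_⟩
  have hi : Integrable (fun p => θ⁻¹ * (diffQuot K u.1 p * diffQuot K u.1 p)) volume :=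
    ((memLp_diffQuot u).integrable_mul (memLp_diffQuot u)).const_mul _
  rw [normX0_sq, innerX0_eq_integral, ← integral_const_mul,
    ofReal_integral_eq_lintegral_ofReal hi
      (ae_of_all _ fun p => mul_nonneg (by positivity) (mul_self_nonneg _)),
    Measure.volume_eq_prod, lintegral_prod _ hi.1.aemeasurable.ennreal_ofReal]
  refine lintegral_mono fun x => lintegral_mono fun y => ENNReal.ofReal_le_ofReal ?_
  rw [diffQuot_mul_diffQuot, ← sq]
  rcases eq_or_ne x y with rfl | hxy
  · simp
  · have h1 := hK _ (sub_ne_zero.mpr hxy)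
    have h2 : ‖x - y‖ ^ (-((n : ℝ) + 2 * s)) ≤ θ⁻¹ * K (x - y) := by
      rw [inv_mul_eq_div, le_div_iff₀ hθ, mul_comm]
      exact h1
    calc _ ≤ (u.1 x - u.1 y) ^ 2 * (θ⁻¹ * K (x - y)) :=
          mul_le_mul_of_nonneg_left h2 (sq_nonneg _)
      _ = _ := by ring

variable (Ω K) in
/-- The critical Sobolev embedding of `X₀`. -/
theorem exists_eLpNorm_critical_le (hs : 0 < s) (hn : 2 * s < n) :
    ∃ C : ℝ, 0 < C ∧ ∀ u : X0 Ω K,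
      eLpNorm u.1 (ENNReal.ofReal (2 * (n : ℝ) / (n - 2 * s))) volume ≤
        ENNReal.ofReal (C * normX0 u) := by
  obtain ⟨C, hC, hG⟩ := exists_lintegral_gagliardoDensity_le Ω K
  set p : ℝ := 2 * (n : ℝ) / (n - 2 * s) with hp
  have hn0 : (0 : ℝ) < n := by linarith
  have hns : (0 : ℝ) < n - 2 * s := by linarith
  have hp0 : 0 < p := by positivity
  have hc : 0 < sobolevConst n s := sobolevConst_pos
  refine ⟨√(C / sobolevConst n s), by positivity, fun u => ?_⟩
  rw [eLpNorm_eq_lintegral_rpow_enorm_toReal (by simpa using hp0) ENNReal.ofReal_ne_top,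
    ENNReal.toReal_ofReal hp0.le]
  have h1 : ∫⁻ y, ‖u.1 y‖ₑ ^ p = ∫⁻ y, ENNReal.ofReal (|u.1 y| ^ p) := by
    refine lintegral_congr fun y => ?_
    rw [← ENNReal.ofReal_rpow_of_nonneg (abs_nonneg _) hp0.le, Real.enorm_eq_ofReal_abs]
  rw [h1]
  have h2 := (sobolev_inequality (memLp_two u) hs hn).trans (ENNReal.rpow_le_rpow
    (ENNReal.div_le_div_right (hG u) _) (by positivity))
  rw [← ENNReal.ofReal_div_of_pos hc] at h2
  refine (ENNReal.rpow_le_rpow h2 (by positivity)).trans (le_of_eq ?_)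
  have h3 : (n : ℝ) / (n - 2 * s) * (1 / p) = 1 / 2 := by rw [hp]; field_simp
  have hN := normX0_nonneg u
  rw [← ENNReal.rpow_mul, h3, ENNReal.ofReal_rpow_of_nonneg (by positivity) (by norm_num),
    ← Real.sqrt_eq_rpow, mul_div_right_comm, Real.sqrt_mul (by positivity), Real.sqrt_sq hN]

variable (Ω K) in
/-- The subcritical Sobolev embedding `X₀ ↪ L^q(Ω)`. -/
theorem exists_integral_rpow_le (hs : 0 < s) (hn : 2 * s < n)
    (hΩ : Bornology.IsBounded (Ω : Set (E n))) {q : ℝ} (hq0 : 0 < q)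
    (hq : q < 2 * (n : ℝ) / (n - 2 * s)) :
    ∃ C : ℝ, 0 < C ∧ ∀ u : X0 Ω K,
      MemLp u.1 (ENNReal.ofReal q) (volume.restrict (Ω : Set (E n))) ∧
      ∫ x in (Ω : Set (E n)), |u.1 x| ^ q ≤ C * normX0 u ^ q := by
  obtain ⟨C, hC, h⟩ := exists_eLpNorm_critical_le Ω K hs hn
  set p : ℝ := 2 * (n : ℝ) / (n - 2 * s) with hp
  have hp0 : 0 < p := hq0.trans hq
  have hfin : IsFiniteMeasure (volume.restrict (Ω : Set (E n))) :=
    ⟨by simpa using hΩ.measure_lt_top⟩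
  set M : ℝ := ((volume.restrict (Ω : Set (E n))) univ ^ (1 / q - 1 / p)).toReal with hM
  have hexp : 0 ≤ 1 / q - 1 / p := sub_nonneg.mpr (one_div_le_one_div_of_le hq0 hq.le)
  have hMe : (volume.restrict (Ω : Set (E n))) univ ^ (1 / q - 1 / p) = ENNReal.ofReal M := by
    rw [hM, ENNReal.ofReal_toReal]
    exact (ENNReal.rpow_lt_top_of_nonneg hexp (measure_ne_top _ _)).ne
  have hM0 : 0 ≤ M := ENNReal.toReal_nonneg
  -- `M` is the Hölder factor from the finite measure of `Ω`; it may vanish when `Ω` is null, and `M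
  -- + 1` keeps the constant positive.
  refine ⟨(C * (M + 1)) ^ q, by positivity, fun u => ?_⟩
  have hN := normX0_nonneg u
  have hum := (memLp_two u).1.restrict (s := (Ω : Set (E n)))
  have h1 : eLpNorm u.1 (ENNReal.ofReal q) (volume.restrict (Ω : Set (E n))) ≤
      ENNReal.ofReal (C * (M + 1) * normX0 u) := by
    refine (eLpNorm_le_eLpNorm_mul_rpow_measure_univ
      (ENNReal.ofReal_le_ofReal hq.le) hum).trans ?_
    rw [ENNReal.toReal_ofReal hq0.le, ENNReal.toReal_ofReal hp0.le, hMe]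
    refine (mul_le_mul_left ((eLpNorm_mono_measure _ Measure.restrict_le_self).trans (h u))
      _).trans ?_
    rw [← ENNReal.ofReal_mul (by positivity)]
    refine ENNReal.ofReal_le_ofReal ?_
    have : 0 ≤ C * normX0 u := by positivity
    nlinarith
  have hmem : MemLp u.1 (ENNReal.ofReal q) (volume.restrict (Ω : Set (E n))) :=
    ⟨hum, h1.trans_lt ENNReal.ofReal_lt_top⟩
  refine ⟨hmem, ?_⟩
  rw [hmem.eLpNorm_eq_integral_rpow_norm (by simpa using hq0) ENNReal.ofReal_ne_top,
    ENNReal.toReal_ofReal hq0.le, ENNReal.ofReal_le_ofReal_iff (by positivity)] at h1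
  have hI : 0 ≤ ∫ x in (Ω : Set (E n)), |u.1 x| ^ q := integral_nonneg fun x => by positivity
  have h2 := Real.rpow_le_rpow (Real.rpow_nonneg hI q⁻¹) h1 hq0.le
  rw [Real.mul_rpow (by positivity) hN] at h2
  simpa only [Real.norm_eq_abs, ← Real.rpow_mul hI, inv_mul_cancel₀ hq0.ne', Real.rpow_one] using h2

/-! ### `X₀` as a Hilbert space. -/

theorem diffQuot_add (u v : E n → ℝ) : diffQuot K (u + v) = diffQuot K u + diffQuot K v := by
  ext p; simp only [diffQuot, Pi.add_apply]; ring

theorem diffQuot_smul (c : ℝ) (u : E n → ℝ) : diffQuot K (c • u) = c • diffQuot K u := by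
  ext p; simp only [diffQuot, Pi.smul_apply, smul_eq_mul]; ring

/-- The space `L²(ℝⁿ)`. -/
abbrev L2 (n : ℕ) : Type := Lp ℝ 2 (volume : Measure (E n))

/-- The space `L²(ℝⁿ) × L²(ℝⁿ × ℝⁿ)`. -/
abbrev GraphSpace (n : ℕ) : Type :=
  WithLp 2 (L2 n × Lp ℝ 2 (volume : Measure (E n × E n)))

variable (Ω K) in
/-- The map `u ↦ (u, diffQuot u)`. -/
def graphEmbedding : X0 Ω K →ₗ[ℝ] GraphSpace n where
  toFun u := WithLp.toLp 2 ((memLp_two u).toLp u.1, (memLp_diffQuot u).toLp (diffQuot K u.1))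
  map_add' u v := by
    rw [← WithLp.toLp_add, Prod.mk_add_mk, ← MemLp.toLp_add, ← MemLp.toLp_add]
    simp_rw [← diffQuot_add]
    rfl
  map_smul' c u := by
    rw [RingHom.id_apply, ← WithLp.toLp_smul, Prod.smul_mk, ← MemLp.toLp_const_smul,
      ← MemLp.toLp_const_smul]
    simp_rw [← diffQuot_smul]
    rfl

theorem graphEmbedding_fst (u : X0 Ω K) :
    (graphEmbedding Ω K u).fst = (memLp_two u).toLp u.1 := rfl

theorem graphEmbedding_snd (u : X0 Ω K) :
    (graphEmbedding Ω K u).snd = (memLp_diffQuot u).toLp (diffQuot K u.1) := rfl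

theorem inner_toLp_toLp (u v : X0 Ω K) :
    inner ℝ ((memLp_two u).toLp u.1) ((memLp_two v).toLp v.1) =
      ∫ x in (Ω : Set (E n)), u.1 x * v.1 x := by
  rw [L2.inner_def, ← integral_indicator Ω.isOpen.measurableSet]
  refine integral_congr_ae ?_
  filter_upwards [(memLp_two u).coeFn_toLp, (memLp_two v).coeFn_toLp, u.2.2] with x h1 h2 h3
  rw [h1, h2]
  by_cases hx : x ∈ (Ω : Set (E n))
  · simp [indicator_of_mem hx, mul_comm]
  · simp [indicator_of_notMem hx, h3 hx]

/-- The elements of `X₀` are functions, not classes. Passing to the range of the graph map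
identifies functions equal a.e. and supplies the inner product `L²` plus `X₀`, in which spectral
theory is applied. -/
theorem inner_graphEmbedding (u v : X0 Ω K) :
    inner ℝ (graphEmbedding Ω K u) (graphEmbedding Ω K v) =
      (∫ x in (Ω : Set (E n)), u.1 x * v.1 x) + innerX0 u v := by
  have h : inner ℝ (graphEmbedding Ω K u) (graphEmbedding Ω K v) =
      inner ℝ (graphEmbedding Ω K u).fst (graphEmbedding Ω K v).fst +
        inner ℝ (graphEmbedding Ω K u).snd (graphEmbedding Ω K v).snd :=
    WithLp.prod_inner_apply _ _
  rw [h, graphEmbedding_fst, graphEmbedding_fst, graphEmbedding_snd,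
    graphEmbedding_snd, inner_toLp_toLp, innerX0_eq_integral, L2.inner_def]
  congr 1
  refine integral_congr_ae ?_
  filter_upwards [(memLp_diffQuot u).coeFn_toLp, (memLp_diffQuot v).coeFn_toLp] with x h1 h2
  rw [h1, h2]
  simp [mul_comm]

variable (Ω K) in
/-- `X₀` is complete. -/
theorem isClosed_range_graphEmbedding :
    IsClosed (LinearMap.range (graphEmbedding Ω K) : Set (GraphSpace n)) := by
  refine IsSeqClosed.isClosed fun x a hx hxa => ?_
  choose u hu using hx
  have h1 : Tendsto (fun j => (memLp_two (u j)).toLp (u j).1) atTop (𝓝 a.fst) := by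
    have := ((WithLp.fstL 2 ℝ (L2 n) (Lp ℝ 2 (volume : Measure (E n × E n)))).continuous.tendsto
      a).comp hxa
    refine this.congr fun j => ?_
    simp [← hu, graphEmbedding_fst]
  have h2 : Tendsto (fun j => (memLp_diffQuot (u j)).toLp (diffQuot K (u j).1)) atTop
      (𝓝 a.snd) := by
    have := ((WithLp.sndL 2 ℝ (L2 n) (Lp ℝ 2 (volume : Measure (E n × E n)))).continuous.tendsto
      a).comp hxa
    refine this.congr fun j => ?_
    simp [← hu, graphEmbedding_snd]
  -- Along a common subsequence both components converge a.e. Since `diffQuot` is computed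
  -- pointwise, the second limit is `diffQuot` of the first, and vanishing outside `Ω` survives.
  obtain ⟨φ, hφ, hφ1⟩ := (tendstoInMeasure_of_tendsto_Lp h1).exists_seq_tendsto_ae
  obtain ⟨ψ, hψ, hψ2⟩ := (tendstoInMeasure_of_tendsto_Lp
    (h2.comp hφ.tendsto_atTop)).exists_seq_tendsto_ae
  have hu1 : ∀ᵐ x : E n, Tendsto (fun j => (u (φ (ψ j))).1 x) atTop (𝓝 (a.fst x)) := by
    filter_upwards [hφ1, ae_all_iff.mpr fun j => (memLp_two (u j)).coeFn_toLp] with x hx h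
    refine (hx.comp hψ.tendsto_atTop).congr fun j => h _
  have hu2 : ∀ᵐ p : E n × E n, Tendsto (fun j => diffQuot K (u (φ (ψ j))).1 p) atTop
      (𝓝 (a.snd p)) := by
    filter_upwards [hψ2, ae_all_iff.mpr fun j => (memLp_diffQuot (u j)).coeFn_toLp] with x hx h
    refine hx.congr fun j => h _
  have hd : a.snd =ᵐ[volume] diffQuot K a.fst := by
    have hp1 : ∀ᵐ p : E n × E n, Tendsto (fun j => (u (φ (ψ j))).1 p.1) atTop (𝓝 (a.fst p.1)) :=
      Measure.quasiMeasurePreserving_fst.ae hu1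
    have hp2 : ∀ᵐ p : E n × E n, Tendsto (fun j => (u (φ (ψ j))).1 p.2) atTop (𝓝 (a.fst p.2)) :=
      Measure.quasiMeasurePreserving_snd.ae hu1
    filter_upwards [hu2, hp1, hp2] with p h h1 h2
    exact tendsto_nhds_unique h ((h1.sub h2).mul_const _)
  have hdm : MemLp (diffQuot K a.fst) 2 volume := (Lp.memLp a.snd).ae_eq hd
  have hv : (a.fst : E n → ℝ) ∈ X0 Ω K := by
    refine ⟨⟨(Lp.memLp a.fst).1.aemeasurable, (Lp.memLp a.fst).restrict _, hdm.restrict _⟩, ?_⟩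
    filter_upwards [hu1, ae_all_iff.mpr fun j => (u j).2.2] with x hx h0 hxΩ
    refine tendsto_nhds_unique hx (tendsto_const_nhds.congr fun j => ?_)
    rw [h0 _ hxΩ]
  refine ⟨⟨a.fst, hv⟩, ?_⟩
  have e1 : (graphEmbedding Ω K ⟨a.fst, hv⟩).fst = a.fst := by
    rw [graphEmbedding_fst, Lp.toLp_coeFn]
  have e2 : (graphEmbedding Ω K ⟨a.fst, hv⟩).snd = a.snd := by
    rw [graphEmbedding_snd]
    exact Lp.ext ((MemLp.coeFn_toLp _).trans hd.symm)
  exact WithLp.ofLp_injective 2 (Prod.ext e1 e2)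

variable (Ω K) in
/-- The image of `X₀` in the graph space. -/
abbrev graphRange : Submodule ℝ (GraphSpace n) := LinearMap.range (graphEmbedding Ω K)

instance : CompleteSpace (graphRange Ω K) :=
  (isClosed_range_graphEmbedding Ω K).completeSpace_coe

variable (Ω K) in
/-- The embedding of `X₀` in `L²(ℝⁿ)`. -/
def toL2 : graphRange Ω K →L[ℝ] L2 n :=
  (WithLp.fstL 2 ℝ (L2 n) (Lp ℝ 2 (volume : Measure (E n × E n)))).comp
    (graphRange Ω K).subtypeL

/-! ### Compactness of the embedding in `L²`. -/

variable (Ω K) in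
/-- Functions in `X₀` are approximated uniformly by functions from a finite-dimensional space. -/
theorem exists_compact_approx (hs : 0 < s) (hΩ : Bornology.IsBounded (Ω : Set (E n)))
    {ε : ℝ} (hε : 0 < ε) :
    ∃ B : L2 n →L[ℝ] L2 n, IsCompactOperator B ∧
      ∀ u : X0 Ω K, ‖(memLp_two u).toLp u.1 - B ((memLp_two u).toLp u.1)‖ ≤ ε * normX0 u := by
  obtain ⟨C, hC, hG⟩ := exists_lintegral_gagliardoDensity_le Ω K
  have hw := unitBallVolume_pos (n := n)
  -- The factor in the deviation estimate scales like `r^{2s}`; `r` is chosen so that, multiplied by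
  -- the constant `C` of the seminorm bound, it equals `ε²`.
  obtain ⟨r, hr, hrε⟩ : ∃ r : ℝ, 0 < r ∧
      (2 * r) ^ ((n : ℝ) + 2 * s) / (r ^ (n : ℝ) * unitBallVolume n) = ε ^ 2 / C := by
    set D := 2 ^ ((n : ℝ) + 2 * s) / unitBallVolume n with hD
    have hDpos : 0 < D := by positivity
    refine ⟨(ε ^ 2 / (C * D)) ^ (1 / (2 * s)), by positivity, ?_⟩
    set r := (ε ^ 2 / (C * D)) ^ (1 / (2 * s)) with hr
    have hr0 : 0 < r := by positivity
    have h1 : r ^ (2 * s) = ε ^ 2 / (C * D) := by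
      rw [hr, ← Real.rpow_mul (by positivity), one_div_mul_cancel (by positivity), Real.rpow_one]
    calc _ = D * r ^ (2 * s) := by
          rw [Real.mul_rpow zero_le_two hr0.le, Real.rpow_add hr0, hD]; field_simp
      _ = _ := by rw [h1]; field_simp
  let z : ℕ → E n := TopologicalSpace.denseSeq (E n)
  let b : ℕ → Set (E n) := fun i => Metric.ball (z i) r
  have hbm : ∀ i, MeasurableSet (b i) := fun i => measurableSet_ball
  have hbf : ∀ i, volume (b i) ≠ ∞ := fun i => measure_ball_lt_top.ne
  let A : ℕ → Set (E n) := fun i => disjointed b i ∩ Ω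
  have hAm : ∀ i, MeasurableSet (A i) := fun i =>
    (MeasurableSet.disjointed hbm i).inter Ω.isOpen.measurableSet
  have hAb : ∀ i, A i ⊆ b i := fun i => inter_subset_left.trans (disjointed_le b i)
  have hAf : ∀ i, volume (A i) ≠ ∞ := fun i => measure_ne_top_of_subset (hAb i) (hbf i)
  have hAdisj : ∀ i j x, x ∈ A i → x ∈ A j → i = j := by
    intro i j x hi hj
    by_contra hij
    exact (disjoint_disjointed b hij).le_bot ⟨hi.1, hj.1⟩
  obtain ⟨m, hm⟩ : ∃ m : ℕ, ∀ x ∈ Ω, ∃ i ∈ Finset.range (m + 1), x ∈ A i := by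
    have hcov : closure (Ω : Set (E n)) ⊆ ⋃ i, b i := by
      intro x _
      obtain ⟨i, hi⟩ := (TopologicalSpace.denseRange_denseSeq (E n)).exists_dist_lt x hr
      exact mem_iUnion.mpr ⟨i, hi⟩
    obtain ⟨t, ht⟩ := hΩ.isCompact_closure.elim_finite_subcover b
      (fun i => Metric.isOpen_ball) hcov
    refine ⟨t.sup id, fun x hx => ?_⟩
    obtain ⟨i, hi, hxi⟩ := mem_iUnion₂.mp (ht (subset_closure hx))
    have hx2 : x ∈ partialSups b (t.sup id) :=
      le_partialSups_of_le b (Finset.le_sup (f := id) hi) hxi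
    rw [← biUnion_range_succ_disjointed] at hx2
    obtain ⟨j, hj, hxj⟩ := mem_iUnion₂.mp hx2
    exact ⟨j, hj, hxj, hx⟩
  -- `B` replaces `u` on each piece `A i` by its mean over the whole ball `b i`. The finitely many
  -- disjoint pieces cover `Ω`, so `B` has finite rank and at each point of `Ω` only one term
  -- survives.
  let B : L2 n →L[ℝ] L2 n := ∑ i ∈ Finset.range (m + 1),
    (innerSL ℝ (indicatorConstLp 2 (hbm i) (hbf i) (1 : ℝ))).smulRight
      ((volume.real (b i))⁻¹ • indicatorConstLp 2 (hAm i) (hAf i) (1 : ℝ))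
  have hB : ∀ u : X0 Ω K, B ((memLp_two u).toLp u.1) =ᵐ[volume] fun x =>
      ∑ i ∈ Finset.range (m + 1), (A i).indicator (fun _ => ⨍ y in b i, u.1 y) x := by
    intro u
    have h1 : B ((memLp_two u).toLp u.1) = ∑ i ∈ Finset.range (m + 1),
        (⨍ y in b i, u.1 y) • indicatorConstLp 2 (hAm i) (hAf i) (1 : ℝ) := by
      simp only [B, sum_apply, ContinuousLinearMap.smulRight_apply,
        innerSL_apply_apply, L2.inner_indicatorConstLp_one]
      refine Finset.sum_congr rfl fun i _ => ?_
      rw [smul_smul, setAverage_eq, smul_eq_mul, mul_comm,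
        integral_congr_ae (ae_restrict_of_ae (memLp_two u).coeFn_toLp)]
    rw [h1]
    refine (Lp.coeFn_finsetSum _ _).trans ?_
    have h2 : ∀ᵐ x : E n, ∀ i : ℕ, ((⨍ y in b i, u.1 y) •
        indicatorConstLp 2 (hAm i) (hAf i) (1 : ℝ) : L2 n) x =
          (A i).indicator (fun _ => ⨍ y in b i, u.1 y) x := by
      refine ae_all_iff.mpr fun i => ?_
      filter_upwards [Lp.coeFn_smul (⨍ y in b i, u.1 y)
        (indicatorConstLp 2 (hAm i) (hAf i) (1 : ℝ)), indicatorConstLp_coeFn (p := 2)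
          (hs := hAm i) (hμs := hAf i) (c := (1 : ℝ))] with x h3 h4
      rw [h3, Pi.smul_apply, h4]
      by_cases hx : x ∈ A i <;> simp [hx]
    filter_upwards [h2] with x hx
    simp [hx]
  refine ⟨B, ?_, fun u => ?_⟩
  · refine Submodule.sum_mem (compactOperator (RingHom.id ℝ) (L2 n) (L2 n))
      (t := Finset.range (m + 1))
      (f := fun i => (innerSL ℝ (indicatorConstLp 2 (hbm i) (hbf i) (1 : ℝ))).smulRight
      ((volume.real (b i))⁻¹ • indicatorConstLp 2 (hAm i) (hAf i) (1 : ℝ))) fun i _ => ?_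
    exact (isCompactOperator_of_locallyCompactSpace_dom (innerSL ℝ
      (indicatorConstLp 2 (hbm i) (hbf i) (1 : ℝ)))).clm_comp
      (ContinuousLinearMap.toSpanSingleton ℝ _)
  · have hN := normX0_nonneg u
    have hpt : ∀ᵐ x : E n, ‖((memLp_two u).toLp u.1 - B ((memLp_two u).toLp u.1) : L2 n) x‖ₑ ^ 2 ≤
        ENNReal.ofReal (ε ^ 2 / C) * gagliardoDensity s u.1 x := by
      filter_upwards [Lp.coeFn_sub ((memLp_two u).toLp u.1) (B ((memLp_two u).toLp u.1)),
        (memLp_two u).coeFn_toLp, hB u, u.2.2] with x h1 h2 h3 h4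
      rw [h1, Pi.sub_apply, h2, h3]
      by_cases hx : x ∈ Ω
      · obtain ⟨i, hi, hxi⟩ := hm x hx
        rw [Finset.sum_eq_single_of_mem i hi fun j _ hji =>
          indicator_of_notMem (fun hxj => hji (hAdisj _ _ x hxj hxi)) _,
          indicator_of_mem hxi, ← hrε]
        refine le_trans (le_of_eq ?_)
          (sq_sub_average_le_gagliardoDensity (memLp_two u) hs hr (hAb i hxi))
        rw [Real.enorm_eq_ofReal_abs, ← ENNReal.ofReal_pow (abs_nonneg _), sq_abs]
      · rw [Finset.sum_eq_zero fun i _ => indicator_of_notMem (fun hxi => hx hxi.2) _, h4 hx]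
        simp
    have h5 : ‖(memLp_two u).toLp u.1 - B ((memLp_two u).toLp u.1)‖ₑ ^ 2 ≤
        ENNReal.ofReal ((ε * normX0 u) ^ 2) := by
      rw [Lp.enorm_def, eLpNorm_eq_lintegral_rpow_enorm_toReal (by norm_num) (by norm_num)]
      rw [← ENNReal.rpow_natCast, ← ENNReal.rpow_mul]
      norm_num
      calc _ ≤ ∫⁻ x, ENNReal.ofReal (ε ^ 2 / C) * gagliardoDensity s u.1 x :=
            lintegral_mono_ae hpt
        _ ≤ ENNReal.ofReal (ε ^ 2 / C) * ENNReal.ofReal (C * normX0 u ^ 2) := by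
            rw [lintegral_const_mul' _ _ ENNReal.ofReal_ne_top]
            gcongr
            exact hG u
        _ = _ := by
            rw [← ENNReal.ofReal_mul (by positivity)]
            congr 1
            field_simp
    rw [← ofReal_norm, ← ENNReal.ofReal_pow (norm_nonneg _),
      ENNReal.ofReal_le_ofReal_iff (by positivity)] at h5
    exact (pow_le_pow_iff_left₀ (norm_nonneg _) (by positivity) two_ne_zero).mp h5

theorem normX0_le_norm_graphEmbedding (u : X0 Ω K) : normX0 u ≤ ‖graphEmbedding Ω K u‖ := by
  refine (pow_le_pow_iff_left₀ (normX0_nonneg u) (norm_nonneg _) two_ne_zero).mp ?_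
  rw [← real_inner_self_eq_norm_sq, inner_graphEmbedding, normX0_sq]
  have : 0 ≤ ∫ x in (Ω : Set (E n)), u.1 x * u.1 x := integral_nonneg fun x => mul_self_nonneg _
  linarith

variable (Ω K) in
/-- `X₀` embeds compactly in `L²`. -/
theorem isCompactOperator_toL2 (hs : 0 < s) (hΩ : Bornology.IsBounded (Ω : Set (E n))) :
    IsCompactOperator (toL2 Ω K) := by
  have h : ∀ j : ℕ, (0 : ℝ) < 1 / ((j : ℝ) + 1) := fun j => by positivity
  choose B hBc hB using fun j => exists_compact_approx Ω K hs hΩ (h j)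
  -- Compact operators are closed under norm limits; the error of the `j`-th approximation is at
  -- most `1/(j+1)`.
  refine isCompactOperator_of_tendsto (l := atTop) (F := fun j => (B j).comp (toL2 Ω K)) ?_
    (Eventually.of_forall fun j => (hBc j).comp_clm _)
  refine (tendsto_iff_norm_sub_tendsto_zero (E := graphRange Ω K →L[ℝ] L2 n)).mpr ?_
  refine squeeze_zero (fun _ => ContinuousLinearMap.opNorm_nonneg _) (fun j => ?_)
    tendsto_one_div_add_atTop_nhds_zero_nat
  refine ContinuousLinearMap.opNorm_le_bound _ (h j).le ?_
  have key : ∀ u : X0 Ω K, ‖B j ((memLp_two u).toLp u.1) - (memLp_two u).toLp u.1‖ ≤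
      1 / ((j : ℝ) + 1) * ‖graphEmbedding Ω K u‖ := fun u => by
    rw [norm_sub_rev]
    exact (hB j u).trans (mul_le_mul_of_nonneg_left (normX0_le_norm_graphEmbedding u) (h j).le)
  rintro ⟨_, u, rfl⟩
  exact key u

/-! ### A spectral bound for compact operators. -/

/-- A bound for `‖A x‖²` on the orthogonal complement of some eigenvectors of `A† A`, in terms of
the remaining eigenvalues. -/
theorem norm_sq_le_of_eigenvalue_le {𝓗 𝓛 ι : Type*} [NormedAddCommGroup 𝓗] [InnerProductSpace ℝ 𝓗]
    [CompleteSpace 𝓗] [NormedAddCommGroup 𝓛] [InnerProductSpace ℝ 𝓛] [CompleteSpace 𝓛]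
    (A : 𝓗 →L[ℝ] 𝓛) (hA : IsCompactOperator A) (v : ι → 𝓗) (c : ι → ℝ)
    (hv : ∀ i h, inner ℝ (A (v i)) (A h) = c i * inner ℝ (v i) h) {b : ℝ} (hb : 0 ≤ b)
    (hw : ∀ w ≠ 0, (∀ i, inner ℝ (v i) w = 0) → ∀ μ : ℝ, μ ≠ 0 →
      (∀ h, inner ℝ (A w) (A h) = μ * inner ℝ w h) → μ ≤ b)
    {x : 𝓗} (hx : ∀ i, inner ℝ (v i) x = 0) : ‖A x‖ ^ 2 ≤ b * ‖x‖ ^ 2 := by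
  let V : Submodule ℝ 𝓗 := (Submodule.span ℝ (range v))ᗮ
  have hV : ∀ w, w ∈ V ↔ ∀ i, inner ℝ (v i) w = 0 := by
    intro w
    simp only [V, Submodule.mem_orthogonal]
    refine ⟨fun h i => h _ (Submodule.subset_span ⟨i, rfl⟩), fun h y hy => ?_⟩
    induction hy using Submodule.span_induction with
    | mem y hy => obtain ⟨i, rfl⟩ := hy; exact h i
    | zero => exact inner_zero_left _
    | add y z _ _ h1 h2 => rw [inner_add_left, h1, h2, add_zero]
    | smul a y _ h1 => rw [inner_smul_left, h1, mul_zero]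
  let T : 𝓗 →L[ℝ] 𝓗 := (ContinuousLinearMap.adjoint A).comp A
  have hT : ∀ y z, inner ℝ (T y) z = inner ℝ (A y) (A z) := fun y z =>
    ContinuousLinearMap.adjoint_inner_left A z (A y)
  have hTc : IsCompactOperator T := hA.clm_comp (ContinuousLinearMap.adjoint A)
  -- `T = A† A` is symmetric and the `v i` are eigenvectors, so their orthogonal complement is
  -- invariant.
  have hTV : ∀ w ∈ V, T w ∈ V := by
    intro w hwV
    rw [hV] at hwV ⊢
    intro i
    rw [real_inner_comm, hT, real_inner_comm, hv, hwV, mul_zero]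
  let S : V →L[ℝ] V := T.restrict hTV
  have hSc : IsCompactOperator S := hTc.restrict' hTV
  have hS : ∀ y z : V, inner ℝ (S y) z = inner ℝ (A y) (A z) := fun y z => hT y z
  have hSs : S.IsSymmetric := fun y z => by
    have h1 := hS y z
    have h2 := hS z y
    rw [real_inner_comm (A (y : 𝓗)), ← real_inner_comm] at h2
    exact h1.trans h2.symm
  -- For a self-adjoint operator the norm is the spectral radius, and for a compact one every
  -- nonzero spectral value is an eigenvalue, to which `hw` applies.
  have hrad : ‖S‖ ≤ b := by
    have h1 := S.spectralRadius_eq_nnnorm hSs.isSelfAdjoint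
    have h2 : spectralRadius ℝ S ≤ ENNReal.ofReal b := by
      refine iSup₂_le fun μ hμ => ?_
      rcases eq_or_ne μ 0 with rfl | hμ0
      · simp
      obtain ⟨w, hw1, hw2⟩ :=
        ((hSc.hasEigenvalue_iff_mem_spectrum hμ0).mpr hμ).exists_hasEigenvector
      rw [Module.End.mem_eigenspace_iff] at hw1
      have hSw : S w = μ • w := hw1
      have hTw : T w = μ • (w : 𝓗) := congrArg Subtype.val hSw
      have hw3 : ∀ h, inner ℝ (A w) (A h) = μ * inner ℝ (w : 𝓗) h := by
        intro h
        rw [← hT, hTw, real_inner_smul_left]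
      have hw0 : (w : 𝓗) ≠ 0 := fun h => hw2 (Subtype.ext h)
      have h3 := hw w hw0 ((hV w).mp w.2) μ hμ0 hw3
      have h4 : 0 ≤ μ := by
        have h5 := hw3 w
        rw [real_inner_self_eq_norm_sq, real_inner_self_eq_norm_sq] at h5
        have h6 : 0 < ‖(w : 𝓗)‖ ^ 2 := by positivity
        by_contra h7
        nlinarith [sq_nonneg ‖A w‖]
      rw [← ENNReal.ofReal_coe_nnreal, coe_nnnorm, Real.norm_of_nonneg h4]
      exact ENNReal.ofReal_le_ofReal h3
    rw [h1, ← ENNReal.ofReal_coe_nnreal, coe_nnnorm, ENNReal.ofReal_le_ofReal_iff hb] at h2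
    exact h2
  have hxV := (hV x).mpr hx
  have h1 := hS ⟨x, hxV⟩ ⟨x, hxV⟩
  rw [real_inner_self_eq_norm_sq] at h1
  calc ‖A x‖ ^ 2 = inner ℝ (S ⟨x, hxV⟩) ⟨x, hxV⟩ := h1.symm
    _ ≤ ‖S ⟨x, hxV⟩‖ * ‖(⟨x, hxV⟩ : V)‖ := real_inner_le_norm _ _
    _ ≤ b * ‖x‖ * ‖x‖ := by
        gcongr
        · exact (S.le_opNorm _).trans (by gcongr; exact le_rfl)
        · exact le_rfl
    _ = _ := by ring

/-! ### Eigenfunctions and Rayleigh quotients. -/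

variable {eig : ℕ → ℝ} {e : ℕ → X0 Ω K}

/-- The `L²(Ω)` inner product. -/
def innerL2 (u v : X0 Ω K) : ℝ := ∫ x in (Ω : Set (E n)), u.1 x * v.1 x

theorem innerL2_comm (u v : X0 Ω K) : innerL2 u v = innerL2 v u := by
  simp only [innerL2, mul_comm]

theorem innerL2_eq_inner (u v : X0 Ω K) :
    innerL2 u v = inner ℝ (graphEmbedding Ω K u).fst (graphEmbedding Ω K v).fst :=
  (inner_toLp_toLp u v).symm

theorem innerL2_self_nonneg (u : X0 Ω K) : 0 ≤ innerL2 u u :=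
  integral_nonneg fun _ => mul_self_nonneg _

variable (Ω K) in
/-- `⟨·, ·⟩_{X₀}` as a bilinear form. -/
def formX0 : LinearMap.BilinForm ℝ (X0 Ω K) :=
  LinearMap.mk₂ ℝ innerX0 innerX0_add_left innerX0_smul_left
    (fun u v w => by rw [innerX0_comm, innerX0_add_left, innerX0_comm v, innerX0_comm w])
    (fun c u v => by rw [innerX0_comm, innerX0_smul_left, innerX0_comm v]; rfl)

theorem innerL2_add_left (u v w : X0 Ω K) : innerL2 (u + v) w = innerL2 u w + innerL2 v w := by
  simp only [innerL2_eq_inner, map_add, WithLp.add_fst, inner_add_left]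

theorem innerL2_smul_left (c : ℝ) (u w : X0 Ω K) : innerL2 (c • u) w = c * innerL2 u w := by
  simp only [innerL2_eq_inner, map_smul, WithLp.smul_fst, real_inner_smul_left]

variable (Ω K) in
/-- The `L²(Ω)` inner product as a bilinear form. -/
def formL2 : LinearMap.BilinForm ℝ (X0 Ω K) :=
  LinearMap.mk₂ ℝ innerL2 innerL2_add_left innerL2_smul_left
    (fun u v w => by rw [innerL2_comm, innerL2_add_left, innerL2_comm v, innerL2_comm w])
    (fun c u v => by rw [innerL2_comm, innerL2_smul_left, innerL2_comm v]; rfl)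

/-- Matches nonzero vectors of the Hilbert space with the nontriviality demanded in
`IsEigenfunction`. -/
theorem graphEmbedding_eq_zero_iff (u : X0 Ω K) :
    graphEmbedding Ω K u = 0 ↔ u.1 =ᵐ[volume] 0 := by
  constructor
  · intro h
    have h1 : (memLp_two u).toLp u.1 = 0 := congrArg WithLp.fst h
    have h2 := (memLp_two u).coeFn_toLp
    rw [h1] at h2
    exact h2.symm.trans (Lp.coeFn_zero _ _ _)
  · intro h
    rw [← inner_self_eq_zero (𝕜 := ℝ), inner_graphEmbedding, innerX0_eq_integral]
    have h1 : ∀ᵐ p : E n × E n, u.1 p.1 = 0 := Measure.quasiMeasurePreserving_fst.ae h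
    have h2 : ∀ᵐ p : E n × E n, u.1 p.2 = 0 := Measure.quasiMeasurePreserving_snd.ae h
    have h3 : ∫ p, diffQuot K u.1 p * diffQuot K u.1 p = 0 := by
      refine integral_eq_zero_of_ae ?_
      filter_upwards [h1, h2] with p hp1 hp2
      simp [diffQuot, hp1, hp2]
    have h4 : ∫ x in (Ω : Set (E n)), u.1 x * u.1 x = 0 := by
      refine integral_eq_zero_of_ae (ae_restrict_of_ae ?_)
      filter_upwards [h] with x hx
      simp [hx]
    rw [h3, h4, add_zero]

namespace IsEigenSequence

theorem innerL2_eq (he : IsEigenSequence eig e) {i j : ℕ} (hi : 1 ≤ i) (hj : 1 ≤ j) :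
    innerL2 (e i) (e j) = if i = j then 1 else 0 := he.orthonormal i j hi hj

theorem innerX0_left (he : IsEigenSequence eig e) {i : ℕ} (hi : 1 ≤ i) (u : X0 Ω K) :
    innerX0 (e i) u = eig i * innerL2 (e i) u := (he.eigen i hi).2 u

theorem innerX0_eq (he : IsEigenSequence eig e) {i j : ℕ} (hi : 1 ≤ i) (hj : 1 ≤ j) :
    innerX0 (e i) (e j) = if i = j then eig i else 0 := by
  rw [he.innerX0_left hi, he.innerL2_eq hi hj, mul_ite, mul_one, mul_zero]

theorem eig_nonneg (he : IsEigenSequence eig e) {i : ℕ} (hi : 1 ≤ i) : 0 ≤ eig i := by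
  have := innerX0_self_nonneg (e i)
  rwa [he.innerX0_eq hi hi, if_pos rfl] at this

/-- The Sobolev embedding with exponent `2`, applied to the normalized `e i`, reads `1 ≤ C λ_i`. -/
theorem eig_pos (he : IsEigenSequence eig e) (hs : 0 < s) (hn : 2 * s < n)
    (hΩ : Bornology.IsBounded (Ω : Set (E n))) {i : ℕ} (hi : 1 ≤ i) : 0 < eig i := by
  have hns : (0 : ℝ) < n - 2 * s := by linarith
  obtain ⟨C, hC, h⟩ := exists_integral_rpow_le Ω K hs hn hΩ zero_lt_two
    (by rw [lt_div_iff₀ hns]; linarith)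
  have h1 := (h (e i)).2
  simp only [Real.rpow_two, sq_abs] at h1
  rw [normX0_sq, he.innerX0_eq hi hi, if_pos rfl] at h1
  have h2 := he.innerL2_eq hi hi
  rw [if_pos rfl, innerL2] at h2
  simp only [sq, h2] at h1
  exact pos_of_mul_pos_right (one_pos.trans_le h1) hC.le

/-- On `span {e_1, …, e_N}` the Rayleigh quotient is at most `λ_N`. -/
theorem innerX0_le_of_mem_H (he : IsEigenSequence eig e) {N : ℕ} {u : X0 Ω K}
    (hu : u ∈ H e N) : innerX0 u u ≤ eig N * innerL2 u u := by
  -- With `u = ∑ c_i e_i`, orthogonality gives `|u|² = ∑ c_i²` and `‖u‖² = ∑ c_i² λ_i`.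
  have hu' : u ∈ Submodule.span ℝ (e '' ((Finset.Icc 1 N : Finset ℕ) : Set ℕ)) := by
    rwa [Finset.coe_Icc]
  obtain ⟨c, hc⟩ := (Submodule.mem_span_image_finset_iff_exists_fun ℝ).mp hu'
  have hi1 : ∀ i : Finset.Icc 1 N, 1 ≤ (i : ℕ) := fun i => (Finset.mem_Icc.mp i.2).1
  have h1 : innerL2 u u = ∑ i, c i * c i := by
    change formL2 Ω K u u = _
    rw [← hc]
    simp only [map_sum, LinearMap.sum_apply, map_smul, LinearMap.smul_apply, smul_eq_mul,
      Finset.mul_sum]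
    refine Finset.sum_congr rfl fun i hi => ?_
    rw [Finset.sum_eq_single_of_mem i hi]
    · change c i * (c i * innerL2 (e i) (e i)) = _
      rw [he.innerL2_eq (hi1 i) (hi1 i), if_pos rfl, mul_one]
    · intro j _ hji
      change c i * (c j * innerL2 (e j) (e i)) = 0
      rw [he.innerL2_eq (hi1 j) (hi1 i), if_neg fun h => hji (Subtype.ext h)]
      simp
  have h2 : innerX0 u u = ∑ i, c i * c i * eig i := by
    change formX0 Ω K u u = _
    rw [← hc]
    simp only [map_sum, LinearMap.sum_apply, map_smul, LinearMap.smul_apply, smul_eq_mul,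
      Finset.mul_sum]
    refine Finset.sum_congr rfl fun i hi => ?_
    rw [Finset.sum_eq_single_of_mem i hi]
    · change c i * (c i * innerX0 (e i) (e i)) = _
      rw [he.innerX0_eq (hi1 i) (hi1 i), if_pos rfl, mul_assoc]
    · intro j _ hji
      change c i * (c j * innerX0 (e j) (e i)) = 0
      rw [he.innerX0_eq (hi1 j) (hi1 i), if_neg fun h => hji (Subtype.ext h)]
      simp
  rw [h1, h2, Finset.mul_sum]
  refine Finset.sum_le_sum fun i _ => ?_
  rw [mul_comm (eig N)]
  exact mul_le_mul_of_nonneg_left (he.mono i N (hi1 i) (Finset.mem_Icc.mp i.2).2)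
    (mul_self_nonneg _)

/-- The variational characterization: on `{e_1, …, e_{k-1}}^⊥` the Rayleigh quotient is at least
`λ_k`. -/
theorem le_innerX0_of_mem_P (he : IsEigenSequence eig e) (hs : 0 < s)
    (hΩ : Bornology.IsBounded (Ω : Set (E n))) {k : ℕ} (hk : 1 ≤ k)
    (hpos : ∀ j, 1 ≤ j → 0 < eig j) {u : X0 Ω K}
    (hu : u ∈ P e (k - 1)) : eig k * innerL2 u u ≤ innerX0 u u := by
  let mk : X0 Ω K → graphRange Ω K := fun w => ⟨graphEmbedding Ω K w, w, rfl⟩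
  have hmk : ∀ w : graphRange Ω K, ∃ v, w = mk v := by
    rintro ⟨_, v, rfl⟩; exact ⟨v, rfl⟩
  have hmk1 : ∀ w v, inner ℝ (mk w) (mk v) = innerL2 w v + innerX0 w v :=
    fun w v => inner_graphEmbedding w v
  have hmk2 : ∀ w v, inner ℝ (toL2 Ω K (mk w)) (toL2 Ω K (mk v)) = innerL2 w v :=
    fun w v => inner_toLp_toLp w v
  have hk0 := hpos k hk
  have hin : ∀ i, 1 ≤ i → ∀ v,
      innerL2 (e i) v = (1 + eig i)⁻¹ * (innerL2 (e i) v + innerX0 (e i) v) := by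
    intro i hi v
    have := hpos i hi
    rw [he.innerX0_left hi]
    field_simp
  have hPm : ∀ v : X0 Ω K, (∀ i : Icc 1 (k - 1), inner ℝ (mk (e i)) (mk v) = 0) ↔
      v ∈ P e (k - 1) := by
    intro v
    have h1 : ∀ i, 1 ≤ i → (inner ℝ (mk (e i)) (mk v) = 0 ↔ innerX0 v (e i) = 0) := by
      intro i hi
      have := hpos i hi
      rw [hmk1, innerX0_comm v, he.innerX0_left hi, ← one_add_mul, mul_eq_zero, mul_eq_zero]
      have h2 : 1 + eig i ≠ 0 := by positivity
      simp [h2, this.ne']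
    constructor
    · intro h j hj1 hj2
      exact (h1 j hj1).mp (h ⟨j, hj1, hj2⟩)
    · rintro h ⟨j, hj1, hj2⟩
      exact (h1 j hj1).mpr (h j hj1 hj2)
  -- For `A` the embedding in `L²`, the equation `A† A w = μ w` says that `w` is an eigenfunction
  -- for `μ⁻¹ - 1`; thus `λ` corresponds to `(1 + λ)⁻¹`, and large `μ` to small `λ`.
  have key := norm_sq_le_of_eigenvalue_le (toL2 Ω K) (isCompactOperator_toL2 Ω K hs hΩ)
    (fun i : Icc 1 (k - 1) => mk (e i)) (fun i => (1 + eig i)⁻¹)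
    (by
      rintro ⟨i, hi⟩ h
      obtain ⟨v, rfl⟩ := hmk h
      rw [hmk2, hmk1]
      exact hin i hi.1 v)
    (b := (1 + eig k)⁻¹) (by positivity)
    (by
      intro w hw0 hw μ hμ0 hμ
      obtain ⟨v, rfl⟩ := hmk w
      have hv0 : ¬ v.1 =ᵐ[volume] 0 := fun h =>
        hw0 (Subtype.ext ((graphEmbedding_eq_zero_iff v).mpr h))
      have hμ' : ∀ φ, innerL2 v φ = μ * (innerL2 v φ + innerX0 v φ) := by
        intro φ
        rw [← hmk1, ← hmk2]
        exact hμ (mk φ)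
      have hX : ∀ φ, innerX0 v φ = (μ⁻¹ - 1) * innerL2 v φ := by
        intro φ
        have h1 := hμ' φ
        have h2 : innerL2 v φ + innerX0 v φ = μ⁻¹ * innerL2 v φ := by
          rw [eq_inv_mul_iff_mul_eq₀ hμ0]
          exact h1.symm
        linarith
      obtain ⟨v', hv', hvv'⟩ := he.exhaust (μ⁻¹ - 1) v ⟨hv0, hX⟩
      -- Otherwise exhaustion and monotonicity put `v`, up to a null set, in `span {e_1, …,
      -- e_{k-1}}`, to which it is orthogonal, so `v` would vanish a.e.
      have hge : eig k ≤ μ⁻¹ - 1 := by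
        by_contra hlt
        push Not at hlt
        apply hv0
        have hsub : e '' {j | 1 ≤ j ∧ eig j = μ⁻¹ - 1} ⊆ e '' Icc 1 (k - 1) := by
          refine image_mono ?_
          rintro j ⟨hj1, hj2⟩
          refine ⟨hj1, ?_⟩
          by_contra hjk
          have := he.mono k j hk (by omega)
          linarith
        have hv'H : v' ∈ Submodule.span ℝ (e '' Icc 1 (k - 1)) := Submodule.span_mono hsub hv'
        have horth : ∀ y ∈ Submodule.span ℝ (e '' Icc 1 (k - 1)), inner ℝ (mk y) (mk v) = 0 := by
          intro y hy
          have hy' : formL2 Ω K y v + formX0 Ω K y v = 0 := by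
            induction hy using Submodule.span_induction with
            | mem y hy =>
              obtain ⟨i, hi, rfl⟩ := hy
              exact (hmk1 _ _).symm.trans (hw ⟨i, hi⟩)
            | zero => simp
            | add y z _ _ h1 h2 =>
              rw [map_add, map_add, LinearMap.add_apply, LinearMap.add_apply]
              linarith
            | smul a y _ h1 =>
              rw [map_smul, map_smul, LinearMap.smul_apply, LinearMap.smul_apply, ← smul_add, h1,
                smul_zero]
          rw [hmk1]
          exact hy'
        have hsame : graphEmbedding Ω K (v - v') = 0 := by
          rw [graphEmbedding_eq_zero_iff]
          filter_upwards [hvv'] with x hx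
          simp [hx]
        rw [map_sub, sub_eq_zero] at hsame
        have hself := horth v' hv'H
        have hmkeq : mk v' = mk v := Subtype.ext hsame.symm
        rw [hmkeq, inner_self_eq_zero] at hself
        exact (graphEmbedding_eq_zero_iff v).mp (congrArg Subtype.val hself)
      have hμpos : 0 < μ := by
        have : 0 < μ⁻¹ := by linarith
        exact inv_pos.mp this
      rw [le_inv_comm₀ hμpos (by positivity)]
      linarith)
    (x := mk u) ((hPm u).mpr hu)
  rw [← real_inner_self_eq_norm_sq, ← real_inner_self_eq_norm_sq, hmk1, hmk2, inv_mul_eq_div,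
    le_div_iff₀ (by positivity)] at key
  linarith

end IsEigenSequence

/-! ### Measurability and growth of the primitive. -/

/-- The superposition of the primitive of a Carathéodory function with a measurable function is
measurable. -/
theorem aemeasurable_integral_of_caratheodory {α : Type*} [MeasurableSpace α] {μ : Measure α}
    {f : α → ℝ → ℝ} (hm : ∀ t, AEMeasurable (fun x => f x t) μ)
    (hc : ∀ᵐ x ∂μ, Continuous (f x)) {u : α → ℝ} (hu : AEMeasurable u μ) :
    AEMeasurable (fun x => ∫ τ in (0 : ℝ)..u x, f x τ) μ := by
  classical
  -- The exceptional null set for a.e. measurability depends on `t`. Fixing it for rational `t` only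
  -- and using continuity yields one good set `S`, on which `f` is genuinely Carathéodory.
  have hq : ∀ᵐ x ∂μ, ∀ r : ℚ, f x r = (hm r).mk _ x :=
    ae_all_iff.mpr fun r => (hm r).ae_eq_mk
  obtain ⟨S, hSm, hSae, hS⟩ : ∃ S : Set α, MeasurableSet S ∧ (∀ᵐ x ∂μ, x ∈ S) ∧
      ∀ x ∈ S, Continuous (f x) ∧ ∀ r : ℚ, f x r = (hm r).mk _ x := by
    obtain ⟨S, hS1, hS2, hS3⟩ := (hc.and hq).exists_measurable_mem
    exact ⟨S, hS2, hS1, hS3⟩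
  let g : ℝ → α → ℝ := fun t => S.indicator fun x => f x t
  have hgc : ∀ x, Continuous fun t => g t x := by
    intro x
    by_cases hx : x ∈ S
    · simpa only [g, indicator_of_mem hx] using (hS x hx).1
    · simpa only [g, indicator_of_notMem hx] using continuous_const
  have hgr : ∀ r : ℚ, Measurable (g r) := by
    intro r
    have : g r = S.indicator ((hm r).mk _) := by
      ext x
      by_cases hx : x ∈ S
      · simp only [g, indicator_of_mem hx, (hS x hx).2 r]
      · simp only [g, indicator_of_notMem hx]
    rw [this]
    exact (hm r).measurable_mk.indicator hSm
  have hgm : ∀ t, Measurable (g t) := by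
    intro t
    obtain ⟨φ, hφ⟩ : ∃ φ : ℕ → ℚ, Tendsto (fun j => (φ j : ℝ)) atTop (𝓝 t) := by
      have ht : t ∈ closure (range ((↑) : ℚ → ℝ)) := Rat.denseRange_cast t
      obtain ⟨y, hy, hyt⟩ := mem_closure_iff_seq_limit.mp ht
      choose φ hφ using hy
      exact ⟨φ, by simpa only [hφ] using hyt⟩
    refine measurable_of_tendsto_metrizable (fun j => hgr (φ j)) ?_
    rw [tendsto_pi_nhds]
    exact fun x => ((hgc x).tendsto t).comp hφ
  have hgu : Measurable (Function.uncurry g) :=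
    measurable_uncurry_of_continuous_of_measurable hgc hgm
  have hgu' : StronglyMeasurable (Function.uncurry fun x τ => g τ x) :=
    (hgu.comp measurable_swap).stronglyMeasurable
  let G : ℝ → α → ℝ := fun t x => ∫ τ in (0 : ℝ)..t, g τ x
  have hGc : ∀ x, Continuous fun t => G t x := fun x =>
    intervalIntegral.continuous_primitive (fun a b => (hgc x).intervalIntegrable a b) 0
  have hGm : ∀ t, Measurable (G t) := by
    intro t
    exact (hgu'.integral_prod_right.measurable).sub (hgu'.integral_prod_right.measurable)
  have hGu : Measurable (Function.uncurry G) :=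
    measurable_uncurry_of_continuous_of_measurable hGc hGm
  refine (hGu.comp_aemeasurable (hu.prodMk aemeasurable_id)).congr ?_
  filter_upwards [hSae] with x hx
  simp only [Function.comp_apply, Function.uncurry, G, g, id, indicator_of_mem hx]

namespace IsNonlinearity

variable {q : ℝ} {f : E n → ℝ → ℝ}

theorem primitive_nonneg (hf : IsNonlinearity Ω s q f) :
    ∀ᵐ x ∂(volume.restrict (Ω : Set (E n))), ∀ t : ℝ, 0 ≤ primitive f x t := by
  filter_upwards [hf.ambrosetti_rabinowitz] with x hx t
  rcases eq_or_ne t 0 with rfl | ht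
  · simp [primitive]
  · have := hf.two_lt
    exact (pos_of_mul_pos_right (hx t ht).1 (by linarith)).le

/-- The primitive is superquadratic at infinity. -/
theorem exists_quadratic_le_primitive (hf : IsNonlinearity Ω s q f) {A : ℝ} (hA : 0 < A) :
    ∃ B : ℝ, 0 < B ∧
      ∀ᵐ x ∂(volume.restrict (Ω : Set (E n))), ∀ t : ℝ, A * t ^ 2 - B ≤ primitive f x t := by
  obtain ⟨a₃, a₄, ha₃, ha₄, h⟩ := hf.primitive_lower
  have hq : 0 < q - 2 := sub_pos.mpr hf.two_lt
  -- Beyond `T` the term `a₃ |t|^q` dominates `A t²`; below it the constant `A T² + a₄` absorbs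
  -- everything.
  set T : ℝ := (A / a₃) ^ (1 / (q - 2)) with hT
  have hTpos : 0 < T := by positivity
  have hTq : a₃ * T ^ (q - 2) = A := by
    rw [hT, ← Real.rpow_mul (by positivity), one_div_mul_cancel hq.ne', Real.rpow_one]
    field_simp
  refine ⟨A * T ^ 2 + a₄, by positivity, ?_⟩
  filter_upwards [h] with x hx t
  refine le_trans ?_ (hx t)
  rcases le_or_gt |t| T with ht | ht
  · have h1 : t ^ 2 ≤ T ^ 2 := by
      rw [← sq_abs]; exact pow_le_pow_left₀ (abs_nonneg t) ht 2
    have h2 : 0 ≤ a₃ * |t| ^ q := by positivity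
    nlinarith
  · have ht0 : 0 < |t| := hTpos.trans ht
    have h1 : |t| ^ q = |t| ^ (q - 2) * t ^ 2 := by
      rw [← sq_abs t, ← Real.rpow_natCast |t| 2, ← Real.rpow_add ht0]; norm_num
    have h2 : T ^ (q - 2) ≤ |t| ^ (q - 2) := Real.rpow_le_rpow hTpos.le ht.le hq.le
    have h3 : A ≤ a₃ * |t| ^ (q - 2) := by rw [← hTq]; gcongr
    have h4 : 0 ≤ A * T ^ 2 := by positivity
    rw [h1]
    nlinarith [sq_nonneg t]

/-- The growth bound for the primitive, with an arbitrarily small quadratic part. -/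
theorem exists_abs_primitive_le (hf : IsNonlinearity Ω s q f) {ε : ℝ} (hε : 0 < ε) :
    ∃ C : ℝ, 0 < C ∧ ∀ᵐ x ∂(volume.restrict (Ω : Set (E n))), ∀ t : ℝ,
      |primitive f x t| ≤ ε * t ^ 2 + C * |t| ^ q := by
  obtain ⟨a₁, a₂, ha₁, ha₂, h⟩ := hf.growth
  have hq := hf.two_lt
  have hq1 : 0 < q - 1 := by linarith
  obtain ⟨δ, hδ, hδf⟩ : ∃ δ : ℝ, 0 < δ ∧ ∀ t : ℝ, t ≠ 0 → |t| < δ → ∀ x ∈ Ω, |f x t| ≤ ε * |t| := by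
    have h1 := Metric.tendstoUniformlyOn_iff.mp hf.superlinear_zero ε hε
    rw [eventually_nhdsWithin_iff, Metric.eventually_nhds_iff] at h1
    obtain ⟨δ, hδ, h2⟩ := h1
    refine ⟨δ, hδ, fun t ht0 ht x hx => ?_⟩
    have h3 := h2 (by simpa using ht) ht0 x hx
    rw [Real.dist_eq, zero_sub, abs_neg, abs_div, abs_abs, div_lt_iff₀ (abs_pos.mpr ht0)] at h3
    exact h3.le
  -- For `|τ| ≥ δ` the constant `a₁` is at most `a₁ (|τ|/δ)^{q-1}`.
  set C : ℝ := a₁ / δ ^ (q - 1) + a₂ with hC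
  refine ⟨C, by positivity, ?_⟩
  filter_upwards [h, ae_restrict_mem Ω.isOpen.measurableSet] with x hx hxΩ t
  have hb : ∀ τ : ℝ, τ ≠ 0 → |f x τ| ≤ ε * |τ| + C * |τ| ^ (q - 1) := by
    intro τ hτ
    rcases lt_or_ge |τ| δ with hlt | hge
    · have := hδf τ hτ hlt x hxΩ
      have h2 : 0 ≤ C * |τ| ^ (q - 1) := by positivity
      linarith
    · have h1 : δ ^ (q - 1) ≤ |τ| ^ (q - 1) := Real.rpow_le_rpow hδ.le hge hq1.le
      have h2 : a₁ ≤ a₁ / δ ^ (q - 1) * |τ| ^ (q - 1) := by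
        rw [div_mul_eq_mul_div, le_div_iff₀ (by positivity)]
        gcongr
      have h3 : 0 ≤ ε * |τ| := by positivity
      rw [hC, add_mul]
      linarith [hx τ]
  rcases eq_or_ne t 0 with rfl | ht
  · simp [primitive, Real.zero_rpow (by linarith : q ≠ 0)]
  have h1 : ‖∫ τ in (0 : ℝ)..t, f x τ‖ ≤ (ε * |t| + C * |t| ^ (q - 1)) * |t - 0| := by
    refine intervalIntegral.norm_integral_le_of_norm_le_const_ae ?_
    -- The limit at `0` is over the punctured neighbourhood, so the bound `hb` omits `τ = 0`, a null
    -- set.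
    have h0 : ∀ᵐ τ : ℝ, τ ≠ 0 := by simp [ae_iff]
    filter_upwards [h0] with τ hτ0 hτ
    refine (hb τ hτ0).trans ?_
    have h2 : |τ| ≤ |t| := by
      rcases mem_uIoc.mp hτ with ⟨h3, h4⟩ | ⟨h3, h4⟩
      · rw [abs_of_pos h3, abs_of_pos (h3.trans_le h4)]; exact h4
      · rw [abs_of_nonpos h4, abs_of_neg (h3.trans_le h4)]; linarith
    gcongr
  have ht0 : 0 < |t| := abs_pos.mpr ht
  have h2 : |t| ^ q = |t| ^ (q - 1) * |t| := by
    rw [← Real.rpow_add_one ht0.ne']; norm_num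
  rw [h2, ← sq_abs t]
  rw [sub_zero, Real.norm_eq_abs] at h1
  refine h1.trans (le_of_eq (by ring))

theorem integrable_primitive (hf : IsNonlinearity Ω s q f) {u : X0 Ω K}
    (huq : Integrable (fun x => |u.1 x| ^ q) (volume.restrict (Ω : Set (E n)))) :
    Integrable (fun x => primitive f x (u.1 x)) (volume.restrict (Ω : Set (E n))) := by
  obtain ⟨C, -, hC⟩ := hf.exists_abs_primitive_le one_pos
  have hu2 : Integrable (fun x => u.1 x ^ 2) (volume.restrict (Ω : Set (E n))) :=
    u.2.1.2.1.integrable_sq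
  refine Integrable.mono' ((hu2.const_mul 1).add (huq.const_mul C))
    (aemeasurable_integral_of_caratheodory hf.measurable hf.continuous
      (u.2.1.1.restrict)).aestronglyMeasurable ?_
  filter_upwards [hC] with x hx
  exact hx _

end IsNonlinearity

/-! ### Estimates of the functional. -/

theorem J_eq (f : E n → ℝ → ℝ) (lam : ℝ) (u : X0 Ω K) :
    J f lam u = 1 / 2 * innerX0 u u - lam / 2 * innerL2 u u
      - ∫ x in (Ω : Set (E n)), primitive f x (u.1 x) := by
  rw [J, integral_sq_eq_innerX0]
  simp only [sq_abs, innerL2, ← sq]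

theorem integrable_sq (u : X0 Ω K) :
    Integrable (fun x => u.1 x ^ 2) (volume.restrict (Ω : Set (E n))) :=
  u.2.1.2.1.integrable_sq

theorem integral_sq_eq_innerL2 (u : X0 Ω K) :
    ∫ x in (Ω : Set (E n)), u.1 x ^ 2 = innerL2 u u := by
  simp only [innerL2, sq]

section Linking

variable {q : ℝ} {f : E n → ℝ → ℝ} {eig : ℕ → ℝ} {e : ℕ → X0 Ω K} {lam : ℝ}

/-- The quadratic part is at most `(λ_N - λ)/2 · |u|² ≤ 0`, and `F ≥ 0`. -/
theorem J_nonpos_of_mem_H (hf : IsNonlinearity Ω s q f) (he : IsEigenSequence eig e) {N : ℕ}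
    (hN : eig N ≤ lam) {u : X0 Ω K} (hu : u ∈ H e N) : J f lam u ≤ 0 := by
  have h1 := he.innerX0_le_of_mem_H hu
  have h2 : 0 ≤ ∫ x in (Ω : Set (E n)), primitive f x (u.1 x) := by
    refine integral_nonneg_of_ae ?_
    filter_upwards [hf.primitive_nonneg] with x hx
    exact hx _
  have h3 := innerL2_self_nonneg u
  rw [J_eq]
  nlinarith

theorem integrable_rpow_of_memLp {u : E n → ℝ} (hq : 0 < q)
    (h : MemLp u (ENNReal.ofReal q) (volume.restrict (Ω : Set (E n)))) :
    Integrable (fun x => |u x| ^ q) (volume.restrict (Ω : Set (E n))) := by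
  have := h.integrable_norm_rpow (by simpa using hq) ENNReal.ofReal_ne_top
  simpa only [ENNReal.toReal_ofReal hq.le, Real.norm_eq_abs] using this

/-- `J_λ` is nonpositive on large spheres of `span {e_1, …, e_N}`. -/
theorem exists_J_nonpos_of_large (hs : 0 < s) (hn : 2 * s < n)
    (hΩ : Bornology.IsBounded (Ω : Set (E n))) (hf : IsNonlinearity Ω s q f)
    (he : IsEigenSequence eig e) (hlam : 0 ≤ lam) {N : ℕ} (hN : 1 ≤ N) :
    ∃ R₀ : ℝ, ∀ u ∈ H e N, R₀ ≤ normX0 u → J f lam u ≤ 0 := by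
  have hpos := he.eig_pos hs hn hΩ hN
  -- With the coefficient `λ_N`, the primitive outweighs the kinetic term: `∫ F ≥ λ_N |u|² - BV ≥
  -- ‖u‖² - BV`. Hence `J ≤ BV - ‖u‖²/2`, which gives the threshold `√(2BV)`.
  obtain ⟨B, hB, hBF⟩ := hf.exists_quadratic_le_primitive hpos
  have hq0 : 0 < q := by linarith [hf.two_lt]
  obtain ⟨C, -, hC⟩ := exists_integral_rpow_le Ω K hs hn hΩ hq0 hf.lt_critical
  have hfin : IsFiniteMeasure (volume.restrict (Ω : Set (E n))) :=
    ⟨by simpa using hΩ.measure_lt_top⟩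
  set V := volume.real (Ω : Set (E n)) with hV
  have hV0 : 0 ≤ V := measureReal_nonneg
  refine ⟨√(2 * (B * V)), fun u hu hR => ?_⟩
  have hR2 : 2 * (B * V) ≤ innerX0 u u := by
    rw [← normX0_sq]
    exact Real.sqrt_le_left (normX0_nonneg u) |>.mp hR
  have h1 := he.innerX0_le_of_mem_H hu
  have h2 : eig N * innerL2 u u - B * V ≤
      ∫ x in (Ω : Set (E n)), primitive f x (u.1 x) := by
    have h3 : ∫ x in (Ω : Set (E n)), (eig N * u.1 x ^ 2 - B) = eig N * innerL2 u u - B * V := by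
      rw [integral_sub ((integrable_sq u).const_mul _) (integrable_const _), integral_const_mul,
        integral_sq_eq_innerL2]
      simp [hV, mul_comm]
    rw [← h3]
    refine integral_mono_ae (((integrable_sq u).const_mul _).sub (integrable_const _))
      (hf.integrable_primitive (integrable_rpow_of_memLp hq0 (hC u).1)) ?_
    filter_upwards [hBF] with x hx
    exact hx _
  have h4 : 0 ≤ lam / 2 * innerL2 u u := mul_nonneg (by linarith) (innerL2_self_nonneg u)
  rw [J_eq]
  linarith

/-- `J_λ` is bounded below by a positive constant on a small sphere of `{e_1, …, e_{k-1}}^⊥`. -/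
theorem exists_pos_le_J (hs : 0 < s) (hn : 2 * s < n)
    (hΩ : Bornology.IsBounded (Ω : Set (E n))) (hf : IsNonlinearity Ω s q f)
    (he : IsEigenSequence eig e) (hlam : 0 ≤ lam) {k : ℕ} (hk : 1 ≤ k) (hlt : lam < eig k) :
    ∃ ρ α : ℝ, 0 < ρ ∧ 0 < α ∧ ∀ u ∈ P e (k - 1), normX0 u = ρ → α ≤ J f lam u := by
  have hk0 := he.eig_pos hs hn hΩ hk
  have hq0 : 0 < q := by linarith [hf.two_lt]
  have hq2 : 0 < q - 2 := sub_pos.mpr hf.two_lt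
  -- This `ε` spends half of the spectral gap: after `|u|² ≤ ρ²/λ_k` the quadratic part is still at
  -- least `κρ²`.
  obtain ⟨C₁, hC₁, hF⟩ := hf.exists_abs_primitive_le (ε := (eig k - lam) / 4) (by linarith)
  obtain ⟨C₂, hC₂, hC⟩ := exists_integral_rpow_le Ω K hs hn hΩ hq0 hf.lt_critical
  set κ := (eig k - lam) / (4 * eig k) with hκ
  have hκ0 : 0 < κ := div_pos (by linarith) (by linarith)
  -- Chosen so that `C₁ C₂ ρ^q = κρ²/2`, leaving `α = κρ²/2`.
  set ρ := (κ / (2 * (C₁ * C₂))) ^ (1 / (q - 2)) with hρ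
  have hρ0 : 0 < ρ := by positivity
  have hρq : C₁ * C₂ * ρ ^ (q - 2) = κ / 2 := by
    rw [hρ, ← Real.rpow_mul (by positivity), one_div_mul_cancel hq2.ne', Real.rpow_one]
    field_simp
  refine ⟨ρ, κ / 2 * ρ ^ 2, hρ0, by positivity, fun u hu hun => ?_⟩
  have h1 := he.le_innerX0_of_mem_P hs hΩ hk (fun j hj => he.eig_pos hs hn hΩ hj) hu
  have hiq := integrable_rpow_of_memLp hq0 (hC u).1
  have h2 : ∫ x in (Ω : Set (E n)), primitive f x (u.1 x) ≤
      (eig k - lam) / 4 * innerL2 u u + C₁ * (C₂ * ρ ^ q) := by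
    calc _ ≤ ∫ x in (Ω : Set (E n)), ((eig k - lam) / 4 * u.1 x ^ 2 + C₁ * |u.1 x| ^ q) := by
          refine integral_mono_ae (hf.integrable_primitive hiq)
            (((integrable_sq u).const_mul _).add (hiq.const_mul _)) ?_
          filter_upwards [hF] with x hx
          exact (le_abs_self _).trans (hx _)
      _ = (eig k - lam) / 4 * innerL2 u u + C₁ * ∫ x in (Ω : Set (E n)), |u.1 x| ^ q := by
          rw [integral_add ((integrable_sq u).const_mul _) (hiq.const_mul _), integral_const_mul,
            integral_const_mul, integral_sq_eq_innerL2]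
      _ ≤ _ := by
          have := (hC u).2
          rw [hun] at this
          gcongr
  have h3 : ρ ^ q = ρ ^ (q - 2) * ρ ^ 2 := by
    rw [← Real.rpow_natCast ρ 2, ← Real.rpow_add hρ0]; norm_num
  have h4 : C₁ * (C₂ * ρ ^ q) = κ / 2 * ρ ^ 2 := by rw [h3, ← hρq]; ring
  have h5 : innerX0 u u = ρ ^ 2 := by rw [← normX0_sq, hun]
  have h6 : innerL2 u u ≤ ρ ^ 2 / eig k := by
    rw [le_div_iff₀ hk0, mul_comm, ← h5]
    exact h1
  have h7 : (eig k + lam) / 4 * innerL2 u u ≤ (eig k + lam) / 4 * (ρ ^ 2 / eig k) := by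
    gcongr
  have h8 : (eig k + lam) / 4 * (ρ ^ 2 / eig k) = ρ ^ 2 / 2 - κ * ρ ^ 2 := by
    rw [hκ]; field_simp; ring
  rw [J_eq, h5]
  rw [h4] at h2
  linarith

end Linking

theorem normX0_smul (c : ℝ) (u : X0 Ω K) : normX0 (c • u) = |c| * normX0 u := by
  refine (pow_left_inj₀ (normX0_nonneg _) (mul_nonneg (abs_nonneg c) (normX0_nonneg u))
    two_ne_zero).mp ?_
  rw [mul_pow, normX0_sq, normX0_sq, innerX0_smul_left, innerX0_comm, innerX0_smul_left, sq_abs]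
  ring

end Nonlocal

end

/-! ### The separation of the two sets. -/

theorem proposition4p1 (n : ℕ) (s : ℝ) (hs0 : 0 < s) (hs1 : s < 1) (hn : 2 * s < (n : ℝ))
    (Ω : TopologicalSpace.Opens (Nonlocal.E n))
    (hΩ : Bornology.IsBounded (Ω : Set (Nonlocal.E n)))
    (K : Nonlocal.Kernel n s)
    (q : ℝ) (f : Nonlocal.E n → ℝ → ℝ) (hf : Nonlocal.IsNonlinearity Ω s q f)
    (eig : ℕ → ℝ) (e : ℕ → Nonlocal.X0 Ω K) (he : Nonlocal.IsEigenSequence eig e)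
    (k m : ℕ) (hk : 2 ≤ k) (hm : 1 ≤ m) (lam : ℝ)
    (h1 : eig (k - 1) < lam) (h2 : lam < eig k)
    (h3 : ∀ j, k ≤ j → j ≤ k + m - 1 → eig j = eig k)
    (h4 : eig (k + m - 1) < eig (k + m))
    (X₁ X₂ X₃ : Submodule ℝ (Nonlocal.X0 Ω K))
    (hX₁ : X₁ = Nonlocal.H e (k - 1))
    (hX₂ : X₂ = Nonlocal.spanE e k (k + m - 1))
    (hX₃ : X₃ = Nonlocal.P e (k + m - 1)) :
    ∃ ρ R : ℝ, 0 < ρ ∧ ρ < R ∧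
      BddAbove (Nonlocal.J f lam ''
        ({u | u ∈ X₁ ∧ Nonlocal.normX0 u ≤ R} ∪
          {u | u ∈ X₁ ⊔ X₂ ∧ Nonlocal.normX0 u = R})) ∧
      BddBelow (Nonlocal.J f lam '' {u | u ∈ X₂ ⊔ X₃ ∧ Nonlocal.normX0 u = ρ}) ∧
      sSup (Nonlocal.J f lam ''
        ({u | u ∈ X₁ ∧ Nonlocal.normX0 u ≤ R} ∪
          {u | u ∈ X₁ ⊔ X₂ ∧ Nonlocal.normX0 u = R})) <
      sInf (Nonlocal.J f lam '' {u | u ∈ X₂ ⊔ X₃ ∧ Nonlocal.normX0 u = ρ}) := by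
  subst hX₁ hX₂ hX₃
  have hlam : 0 ≤ lam := (he.eig_nonneg (by omega : 1 ≤ k - 1)).trans h1.le
  obtain ⟨R₀, hR₀⟩ := Nonlocal.exists_J_nonpos_of_large hs0 hn hΩ hf he hlam
    (by omega : 1 ≤ k + m - 1)
  obtain ⟨ρ, α, hρ, hα, hJ⟩ := Nonlocal.exists_pos_le_J hs0 hn hΩ hf he hlam
    (by omega : 1 ≤ k) h2
  have hle : Nonlocal.H e (k - 1) ⊔ Nonlocal.spanE e k (k + m - 1) ≤ Nonlocal.H e (k + m - 1) :=
    sup_le (Submodule.span_mono (image_mono (Icc_subset_Icc_right (by omega))))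
      (Submodule.span_mono (image_mono (Icc_subset_Icc_left (by omega))))
  have hge : Nonlocal.spanE e k (k + m - 1) ⊔ Nonlocal.P e (k + m - 1) ≤
      Nonlocal.P e (k - 1) := by
    refine sup_le (Submodule.span_le.mpr ?_) fun u hu j hj1 hj2 => hu j hj1 (by omega)
    rintro _ ⟨i, ⟨hi1, hi2⟩, rfl⟩ j hj1 hj2
    rw [he.innerX0_eq (by omega) hj1, if_neg (by omega)]
  have hsup : ∀ y ∈ Nonlocal.J f lam ''
      ({u | u ∈ Nonlocal.H e (k - 1) ∧ Nonlocal.normX0 u ≤ max R₀ (ρ + 1)} ∪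
        {u | u ∈ Nonlocal.H e (k - 1) ⊔ Nonlocal.spanE e k (k + m - 1) ∧
          Nonlocal.normX0 u = max R₀ (ρ + 1)}), y ≤ 0 := by
    rintro _ ⟨u, ⟨hu, -⟩ | ⟨hu, huR⟩, rfl⟩
    · exact Nonlocal.J_nonpos_of_mem_H hf he h1.le hu
    · exact hR₀ u (hle hu) (huR ▸ le_max_left _ _)
  have hinf : ∀ y ∈ Nonlocal.J f lam ''
      {u | u ∈ Nonlocal.spanE e k (k + m - 1) ⊔ Nonlocal.P e (k + m - 1) ∧
        Nonlocal.normX0 u = ρ}, α ≤ y := by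
    rintro _ ⟨u, ⟨hu, huρ⟩, rfl⟩
    exact hJ u (hge hu) huρ
  -- In `ℝ` the infimum of the empty set is `0`, so positivity of the infimum needs a point on the
  -- sphere: a multiple of `e_k`, which lies in `X₂` because `m ≥ 1`.
  have hne : (Nonlocal.J f lam ''
      {u | u ∈ Nonlocal.spanE e k (k + m - 1) ⊔ Nonlocal.P e (k + m - 1) ∧
        Nonlocal.normX0 u = ρ}).Nonempty := by
    have hk0 := he.eig_pos hs0 hn hΩ (by omega : 1 ≤ k)
    have hnk : 0 < Nonlocal.normX0 (e k) := by
      have h5 := Nonlocal.normX0_sq (e k)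
      rw [he.innerX0_eq (by omega) (by omega), if_pos rfl] at h5
      exact (Nonlocal.normX0_nonneg _).lt_of_ne fun h0 => by
        rw [← h0] at h5
        norm_num at h5
        linarith
    refine Set.Nonempty.image _ ⟨(ρ / Nonlocal.normX0 (e k)) • e k, ?_, ?_⟩
    · exact Submodule.smul_mem _ _ (Submodule.mem_sup_left
        (Submodule.subset_span ⟨k, ⟨le_rfl, by omega⟩, rfl⟩))
    · rw [Nonlocal.normX0_smul, abs_of_pos (by positivity), div_mul_cancel₀ _ hnk.ne']
  -- `R₀` bears no relation to `ρ`; the maximum ensures `R > ρ` as well as `R ≥ R₀`.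
  refine ⟨ρ, max R₀ (ρ + 1), hρ, lt_max_of_lt_right (lt_add_one ρ), ⟨0, hsup⟩, ⟨α, hinf⟩, ?_⟩
  exact (Real.sSup_nonpos hsup).trans_lt (hα.trans_le (le_csInf hne hinf))
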